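/- **Definitions.** A point configuration is a finite labelled family $\mathcal A=(a_i)_{i\in I}$ of points of $\mathbb R^d$; its subsets are identified with sets of labels. The determinant of $d+1$ of its points is that of the $(d+1)\times(d+1)$ matrix whose columns are the points with an additional first coordinate $1$. $\mathcal A$ is in *general position* if no determinant of $d+1$ distinctly labelled points vanishes (no $d+1$ points lie in an affine hyperplane). A configuration $\mathcal A'$ with the same label set in the same $\mathbb R^d$ is a *perturbation* of $\mathcal A$ if every determinant of $d+1$ points that is non-zero in $\mathcal A$ has the same sign in $\mathcal A'$. A *triangulation* of $\mathcal A$ is a collection $T$ of affinely independent subsets $\sigma\subseteq\mathcal A$ with the same affine span as $\mathcal A$ such that $\operatorname{conv}\sigma\cap\operatorname{conv}\sigma'$ is a (possibly empty) face of both $\operatorname{conv}\sigma$ and $\operatorname{conv}\sigma'$ for all $\sigma,\sigma'\in T$, and $\bigcup_{\sigma\in T}\operatorname{conv}\sigma=\operatorname{conv}\mathcal A$. Not all points need be used. A *circuit* is a minimal affinely dependent subset $C$; its affine dependence $\sum_{c\in C}\lambda_c c=0$, $\sum_c\lambda_c=0$ (unique up to a non-zero factor) splits it into $C_+=\{c:\lambda_c>0\}$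 and $C_-=\{c:\lambda_c<0\}$. Put $T^C_\pm=\{C\setminus\{c\}:c\in C_\pm\}$, and for $\tau\subseteq\mathcal A$ let $\operatorname{link}_T(\tau)=\{\rho\subseteq\mathcal A:\rho\cap\tau=\emptyset,\ \rho\cup\tau\in T\}$. If all $\tau\in T^C_+$ have one and the same non-empty link $L$ in $T_1$, then the triangulation $$T_2=\bigl(T_1\setminus\{\rho\cup\tau:\rho\in L,\tau\in T^C_+\}\bigr)\cup\{\rho\cup\tau:\rho\in L,\tau\in T^C_-\}$$ is obtained from $T_1$ by a *flip*. The *flip graph* of $\mathcal A$ has the triangulations of $\mathcal A$ as vertices and the flips between them as edges. For $t\in\mathbb R$ let $\mathcal A(t)\subset\mathbb R^6$ consist of the 17 points $O=(0,0,0,0,0,0)$ and $$\begin{aligned} a_1^\pm(t)&=(\pm1,\pm t,0,0,\sqrt2,0), & a_5^\pm(t)&=(\pm1,\mp t,0,0,-\sqrt2,0),\\ a_2^\pm(t)&=(\mp t,\pm1,0,0,1,1), & a_6^\pm(t)&=(\pm t,\pm1,0,0,-1,-1),\\ a_3^\pm(t)&=(0,0,\pm1,\pm t,0,\sqrt2),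 & a_7^\pm(t)&=(0,0,\pm1,\mp t,0,-\sqrt2),\\ a_4^\pm(t)&=(0,0,\mp t,\pm1,-1,1), & a_8^\pm(t)&=(0,0,\pm t,\pm1,1,-1). \end{aligned}$$ **Theorem.** For all sufficiently small $t>0$, $\mathcal A(t)$ is a perturbation of $\mathcal A(0)$. For every $t>0$ such that $\mathcal A(t)$ is a perturbation of $\mathcal A(0)$, and for every perturbation $\mathcal A'$ of $\mathcal A(t)$ that is in general position, the flip graph of $\mathcal A'$ is not connected: there are two triangulations of $\mathcal A'$ that are not joined by any sequence of flips. -/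

import Mathlib

namespace PointConfig

variable {ι : Type*} [Fintype ι] [DecidableEq ι] {d : ℕ}

/-- The points of a configuration are the values of a map `A : ι → ℝᵈ`; subsets of the
configuration are given by their labels. This is the convex hull of the points labelled by `σ`. -/
def conv (A : ι → Fin d → ℝ) (σ : Finset ι) : Set (Fin d → ℝ) :=
  convexHull ℝ (A '' (σ : Set ι))

/-- The determinant of the `d + 1` points labelled by `s 0, …, s d`: the points are written
as columns, and a first row of ones is added as homogenization coordinate. -/
noncomputable def orientDet (A : ι → Fin d → ℝ) (s : Fin (d + 1) → ι) : ℝ :=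
  Matrix.det (Matrix.of fun (r c : Fin (d + 1)) =>
    (Fin.cons (1 : ℝ) (A (s c)) : Fin (d + 1) → ℝ) r)

/-- General position: none of the determinants of `d + 1` (differently labelled) points vanishes,
that is, no `d + 1` of the points lie in an affine hyperplane. -/
def InGeneralPosition (A : ι → Fin d → ℝ) : Prop :=
  ∀ s : Fin (d + 1) → ι, Function.Injective s → orientDet A s ≠ 0

/-- `A'` is a perturbation of `A`: all the determinants of `d + 1` points that are not zero
in `A` keep their sign in `A'`. -/
def IsPerturbation (A A' : ι → Fin d → ℝ) : Prop :=
  ∀ s : Fin (d + 1) → ι, orientDet A s ≠ 0 →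
    SignType.sign (orientDet A' s) = SignType.sign (orientDet A s)

/-- Triangulations of a point configuration, given by their sets of maximal cells.
A face of a polytope (possibly empty, possibly the whole polytope) is an exposed subset. -/
structure IsTriangulation (A : ι → Fin d → ℝ) (T : Finset (Finset ι)) : Prop where
  affineIndependent : ∀ σ ∈ T, AffineIndependent ℝ (fun i : σ => A i)
  spanning : ∀ σ ∈ T, affineSpan ℝ (A '' (σ : Set ι)) = affineSpan ℝ (Set.range A)
  inter_isFace : ∀ σ ∈ T, ∀ σ' ∈ T,
    IsExposed ℝ (conv A σ) (conv A σ ∩ conv A σ') ∧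
      IsExposed ℝ (conv A σ') (conv A σ ∩ conv A σ')
  cover : ⋃ σ ∈ T, conv A σ = convexHull ℝ (Set.range A)

/-- `(P, M)` is an oriented circuit `(C₊, C₋)`: the union `P ∪ M` is a minimal affinely dependent
set, and `P`, `M` are the sets of labels with positive, respectively negative, coefficient
in an affine dependence supported on it. -/
def IsOrientedCircuit (A : ι → Fin d → ℝ) (P M : Finset ι) : Prop :=
  (¬ AffineIndependent ℝ (fun i : (P ∪ M : Finset ι) => A i)) ∧
  (∀ D : Finset ι, D ⊂ P ∪ M → AffineIndependent ℝ (fun i : D => A i)) ∧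
  ∃ w : ι → ℝ, ∑ i, w i = 0 ∧ ∑ i, w i • A i = 0 ∧
    (∀ i, i ∈ P ↔ 0 < w i) ∧ (∀ i, i ∈ M ↔ w i < 0)

/-- The link of `τ` in `T`. -/
def link (T : Finset (Finset ι)) (τ : Finset ι) : Finset (Finset ι) :=
  Finset.univ.filter fun ρ => Disjoint ρ τ ∧ ρ ∪ τ ∈ T

/-- For an oriented circuit `(P, M)`, the triangulation `{C \ {c} : c ∈ P}` of `C = P ∪ M`;
the other triangulation of `C` is `circuitTriangulation M P`. -/
def circuitTriangulation (P M : Finset ι) : Finset (Finset ι) :=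
  P.image fun c => (P ∪ M).erase c

/-- The sets `ρ ∪ τ` with `ρ ∈ L` and `τ ∈ S`. -/
def join (L S : Finset (Finset ι)) : Finset (Finset ι) :=
  (L ×ˢ S).image fun x => x.1 ∪ x.2

/-- `T₂` is obtained from `T₁` by a geometric bistellar flip: for some oriented circuit `(P, M)`
all the cells of the triangulation `{C \ {c} : c ∈ P}` of `C = P ∪ M` are simplices of `T₁` with
the same link `L`, and in `T₂` their joins with `L` are replaced by those of the other
triangulation of `C`. Non-emptiness of the link says that the cells are faces of cells of `T₁`. -/
def IsFlip (A : ι → Fin d → ℝ) (T₁ T₂ : Finset (Finset ι)) : Prop :=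
  ∃ (P M : Finset ι) (L : Finset (Finset ι)),
    IsOrientedCircuit A P M ∧ L.Nonempty ∧
    (∀ τ ∈ circuitTriangulation P M, link T₁ τ = L) ∧
    T₂ = (T₁ \ join L (circuitTriangulation P M)) ∪ join L (circuitTriangulation M P)

/-- The graph of flips (graph of triangulations): its vertices are all the triangulations of `A`,
its edges are the flips between them. -/
def flipGraph (A : ι → Fin d → ℝ) :
    SimpleGraph {T : Finset (Finset ι) // IsTriangulation A T} :=
  SimpleGraph.fromRel fun T₁ T₂ => IsFlip A T₁.1 T₂.1

/-- The 17 points `O, a₁⁺(t), …, a₈⁺(t), a₁⁻(t), …, a₈⁻(t)` of `ℝ⁶`, in this order. -/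
noncomputable def config17 (t : ℝ) : Fin 17 → Fin 6 → ℝ :=
  ![![ 0,  0,  0,  0,   0,   0],
    ![ 1,  t,  0,  0,  √2,   0],
    ![-t,  1,  0,  0,   1,   1],
    ![ 0,  0,  1,  t,   0,  √2],
    ![ 0,  0, -t,  1,  -1,   1],
    ![ 1, -t,  0,  0, -√2,   0],
    ![ t,  1,  0,  0,  -1,  -1],
    ![ 0,  0,  1, -t,   0, -√2],
    ![ 0,  0,  t,  1,   1,  -1],
    ![-1, -t,  0,  0,  √2,   0],
    ![ t, -1,  0,  0,   1,   1],
    ![ 0,  0, -1, -t,   0,  √2],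
    ![ 0,  0,  t, -1,  -1,   1],
    ![-1,  t,  0,  0, -√2,   0],
    ![-t, -1,  0,  0,  -1,  -1],
    ![ 0,  0, -1,  t,   0, -√2],
    ![ 0,  0, -t, -1,   1,  -1]]

end PointConfig

set_option linter.unusedSectionVars false

open Finset Filter Topology

namespace PointConfig

/-! ### Barycentric coordinates and the local constancy of the cell count -/

section Criterion

variable {ι : Type*} {d : ℕ}

/-! The proof exhibits a set K of full-dimensional cells that flips can neither destroy nor create
as a whole. One explicit triangulation contains K and another does not, so they lie in different
components.

In general position a circuit has d + 2 elements and all cells have d + 1, so a flip merely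
exchanges the two triangulations of a circuit C. Suppose it removes a cell κ = C \ {x} of K.
Lockedness (`IsLocked`) supplies a ridge κ \ {e} that separates x from e and is shared with a second
cell of K, with apex o ≠ x on the side of x. The dependence on C then gives e and x the same sign,
so the flip also requires the cell C \ {e} in the triangulation. That cell lies over the same ridge
and on the same side as the cell with apex o, so the two overlap improperly: a contradiction.
Applied to the reversed circuit, the argument shows that a flip does not create a cell of K either,
so `K ⊆ T` is invariant under flips.

Here K consists of 64 cells: O, a triangle from one cyclic strip of eight triangles, and a triangle
from a second such strip. Replacing an outer vertex of either triangle by the next point along its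
strip leads to another cell of K, which gives the four ridges used for locking. The second
triangulation is the cone from O over the boundary of the convex hull.

That the two lists of cells are triangulations follows from a combinatorial criterion
(`IsPseudoManifold`): every ridge is either shared by exactly two cells on opposite sides, or lies
in one cell only and has all other points strictly on one side. The number of cells over a generic
point cannot change when such a ridge is crossed, and it is one near the boundary, hence everywhere;
this yields both covering and proper intersection.

All conditions are thus signs of determinants. For A(t) these are polynomials in t over ℤ[√2] with
signs certified on (0, 3/10); one determinant shows that every admissible t lies in this interval.
Only non-zero signs are used, so they pass to every perturbation A'. -/

theorem affineMap_sum_smul {κ : Type*} (s : Finset κ) (w : κ → ℝ) (p : κ → Fin d → ℝ)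
    (hw : ∑ i ∈ s, w i = 1) (f : (Fin d → ℝ) →ᵃ[ℝ] ℝ) :
    f (∑ i ∈ s, w i • p i) = ∑ i ∈ s, w i * f (p i) := by
  have hdec : ∀ x, f x = f.linear x + f 0 := fun x => by
    have := congrFun f.decomp x
    simpa using this
  rw [hdec, map_sum]
  simp only [map_smul, smul_eq_mul]
  have : ∑ i ∈ s, w i * f (p i) = ∑ i ∈ s, (w i * f.linear (p i) + w i * f 0) :=
    Finset.sum_congr rfl fun i _ => by rw [hdec (p i)]; ring
  rw [this, Finset.sum_add_distrib, ← Finset.sum_mul, hw, one_mul]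

theorem affineMap_lineMap (f : (Fin d → ℝ) →ᵃ[ℝ] ℝ) (x y : Fin d → ℝ) (ε : ℝ) :
    f (AffineMap.lineMap x y ε) = (1 - ε) * f x + ε * f y := by
  rw [AffineMap.apply_lineMap, AffineMap.lineMap_apply_module]
  simp

/-- Barycentric coordinates with respect to a full-dimensional simplex. -/
structure IsBary (A : ι → Fin d → ℝ) (σ : Finset ι) (b : ι → (Fin d → ℝ) →ᵃ[ℝ] ℝ) : Prop where
  sum_eq : ∀ x, ∑ i ∈ σ, b i x = 1
  combo : ∀ x, ∑ i ∈ σ, b i x • A i = x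
  apply_same : ∀ i ∈ σ, b i (A i) = 1
  apply_ne : ∀ i ∈ σ, ∀ j ∈ σ, i ≠ j → b i (A j) = 0

namespace IsBary

variable {A : ι → Fin d → ℝ} {σ : Finset ι} {b : ι → (Fin d → ℝ) →ᵃ[ℝ] ℝ}

theorem map_eq (h : IsBary A σ b) (f : (Fin d → ℝ) →ᵃ[ℝ] ℝ) (x : Fin d → ℝ) :
    f x = ∑ i ∈ σ, b i x * f (A i) := by
  conv_lhs => rw [← h.combo x]
  exact affineMap_sum_smul σ _ A (h.sum_eq x) f

theorem nonempty (h : IsBary A σ b) : σ.Nonempty := by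
  by_contra hne
  rw [Finset.not_nonempty_iff_eq_empty] at hne
  have := h.sum_eq 0
  simp [hne] at this

theorem mem_conv_iff (h : IsBary A σ b) {x : Fin d → ℝ} :
    x ∈ conv A σ ↔ ∀ i ∈ σ, 0 ≤ b i x := by
  constructor
  · intro hx i hi
    have hc : Convex ℝ {y | 0 ≤ b i y} := (convex_Ici (0 : ℝ)).affine_preimage (b i)
    refine convexHull_min ?_ hc hx
    rintro _ ⟨j, hj, rfl⟩
    by_cases hij : i = j
    · subst hij; simp [h.apply_same i hi]
    · simp [h.apply_ne i hi j hj hij]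
  · intro hx
    rw [← h.combo x]
    exact (convex_convexHull ℝ _).sum_mem hx (h.sum_eq x)
      fun i hi => subset_convexHull ℝ _ ⟨i, hi, rfl⟩

theorem coeff_eq (h : IsBary A σ b) {τ : Finset ι} (hτ : τ ⊆ σ) (w : ι → ℝ)
    (hw : ∑ k ∈ τ, w k = 1) {i : ι} (hi : i ∈ τ) :
    b i (∑ k ∈ τ, w k • A k) = w i := by
  rw [affineMap_sum_smul τ w A hw, Finset.sum_eq_single i]
  · rw [h.apply_same i (hτ hi), mul_one]
  · intro k hk hki
    rw [h.apply_ne i (hτ hi) k (hτ hk) hki.symm, mul_zero]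
  · exact fun h => absurd hi h

theorem coeff_eq_zero (h : IsBary A σ b) {τ : Finset ι} (hτ : τ ⊆ σ) (w : ι → ℝ)
    (hw : ∑ k ∈ τ, w k = 1) {i : ι} (hi : i ∈ σ) (hiτ : i ∉ τ) :
    b i (∑ k ∈ τ, w k • A k) = 0 := by
  rw [affineMap_sum_smul τ w A hw]
  refine Finset.sum_eq_zero fun k hk => ?_
  rw [h.apply_ne i hi k (hτ hk) (by rintro rfl; exact hiτ hk), mul_zero]

/-- A subset of the vertices has points all of whose barycentric coordinates are positive on it. -/
theorem exists_pos (h : IsBary A σ b) {τ : Finset ι} (hτ : τ ⊆ σ) (hne : τ.Nonempty) :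
    ∃ z : Fin d → ℝ, (∀ i ∈ τ, 0 < b i z) ∧ ∀ i ∈ σ, i ∉ τ → b i z = 0 := by
  have hc : (0 : ℝ) < #τ := by exact_mod_cast hne.card_pos
  have hw : ∑ _k ∈ τ, (#τ : ℝ)⁻¹ = 1 := by
    rw [Finset.sum_const, nsmul_eq_mul, mul_inv_cancel₀ hc.ne']
  refine ⟨∑ k ∈ τ, (#τ : ℝ)⁻¹ • A k, fun i hi => ?_, fun i hi hiτ => ?_⟩
  · rw [h.coeff_eq hτ (fun _ => (#τ : ℝ)⁻¹) hw hi]; exact inv_pos.2 hc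
  · exact h.coeff_eq_zero hτ (fun _ => (#τ : ℝ)⁻¹) hw hi hiτ

theorem isClosed_conv (h : IsBary A σ b) : IsClosed (conv A σ) := by
  have : conv A σ = ⋂ i ∈ σ, {x | 0 ≤ b i x} := by
    ext x; simp [h.mem_conv_iff]
  rw [this]
  exact isClosed_biInter fun i _ =>
    isClosed_le continuous_const (b i).continuous_of_finiteDimensional

/-- Change of coordinates between two simplices that share a ridge: the affine functions of the
first are evaluated on the vertices of the second, where all but one or two terms vanish. -/
theorem eq_of_insert [DecidableEq ι] (h : IsBary A σ b) {i j : ι} {c : ι → (Fin d → ℝ) →ᵃ[ℝ] ℝ}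
    (hj : j ∉ σ) (h' : IsBary A (insert j (σ.erase i)) c) (x : Fin d → ℝ) :
    (i ∈ σ → b i x = c j x * b i (A j)) ∧
      ∀ k ∈ σ.erase i, b k x = c k x + c j x * b k (A j) := by
  have hj' : j ∉ σ.erase i := fun h => hj (Finset.mem_of_mem_erase h)
  constructor
  · intro hi
    rw [h'.map_eq (b i) x, Finset.sum_insert hj', Finset.sum_eq_zero, add_zero]
    intro k hk
    rw [h.apply_ne i hi k (Finset.mem_of_mem_erase hk) (Finset.ne_of_mem_erase hk).symm, mul_zero]
  · intro k hk
    rw [h'.map_eq (b k) x, Finset.sum_insert hj', Finset.sum_eq_single k, add_comm,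
      h.apply_same k (Finset.mem_of_mem_erase hk), mul_one]
    · intro m hm hmk
      rw [h.apply_ne k (Finset.mem_of_mem_erase hk) m (Finset.mem_of_mem_erase hm) hmk.symm,
        mul_zero]
    · exact fun h => absurd hk h

end IsBary

/-- An open set contains points at which finitely many non-zero affine functions do not vanish. -/
theorem exists_mem_open_ne_zero {κ : Type*} (s : Finset κ) (g : κ → (Fin d → ℝ) →ᵃ[ℝ] ℝ)
    (hg : ∀ k ∈ s, ∃ z, g k z ≠ 0) {V : Set (Fin d → ℝ)} (hV : IsOpen V) (hne : V.Nonempty) :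
    ∃ y ∈ V, ∀ k ∈ s, g k y ≠ 0 := by
  classical
  induction s using Finset.induction_on generalizing V with
  | empty => exact ⟨_, hne.some_mem, by simp⟩
  | insert a s _ ih =>
    have ho : IsOpen (V ∩ {y | g a y ≠ 0}) :=
      hV.inter (isOpen_ne_fun (g a).continuous_of_finiteDimensional continuous_const)
    have hn : (V ∩ {y | g a y ≠ 0}).Nonempty := by
      obtain ⟨y, hy⟩ := hne
      by_cases h0 : g a y = 0
      · obtain ⟨z, hz⟩ := hg a (Finset.mem_insert_self a s)
        have hcont : Tendsto (fun ε : ℝ => AffineMap.lineMap y z ε) (𝓝[>] 0) (𝓝 y) := by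
          have h1 : Continuous fun ε : ℝ => (AffineMap.lineMap y z ε : Fin d → ℝ) :=
            AffineMap.lineMap_continuous
          have := h1.tendsto 0
          rw [AffineMap.lineMap_apply_zero] at this
          exact this.mono_left nhdsWithin_le_nhds
        obtain ⟨ε, hε, hpos⟩ := ((hcont.eventually (hV.mem_nhds hy)).and
          self_mem_nhdsWithin).exists
        refine ⟨_, hε, ?_⟩
        have hpos : (0 : ℝ) < ε := hpos
        simp only [Set.mem_ofPred_eq, affineMap_lineMap, h0, mul_zero, zero_add]
        exact mul_ne_zero hpos.ne' hz
      · exact ⟨y, hy, h0⟩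
    obtain ⟨y, hy, hys⟩ := ih (fun k hk => hg k (Finset.mem_insert_of_mem hk)) ho hn
    refine ⟨y, hy.1, fun k hk => ?_⟩
    rcases Finset.mem_insert.1 hk with rfl | hk
    · exact hy.2
    · exact hys k hk

open Classical in
/-- Twice the indicator of a simplex, with half of that value on the boundary. -/
noncomputable def weight (σ : Finset ι) (b : ι → (Fin d → ℝ) →ᵃ[ℝ] ℝ) (x : Fin d → ℝ) : ℤ :=
  if ∀ i ∈ σ, 0 < b i x then 2 else if ∀ i ∈ σ, 0 ≤ b i x then 1 else 0

/-- Number of cells of `S` at a point, counted by `weight`. -/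
noncomputable def cellCount (S : Finset (Finset ι)) (b : Finset ι → ι → (Fin d → ℝ) →ᵃ[ℝ] ℝ)
    (x : Fin d → ℝ) : ℤ :=
  ∑ σ ∈ S, weight σ (b σ) x

theorem weight_of_pos {σ : Finset ι} {b : ι → (Fin d → ℝ) →ᵃ[ℝ] ℝ} {x : Fin d → ℝ}
    (h : ∀ i ∈ σ, 0 < b i x) : weight σ b x = 2 := if_pos h

theorem weight_of_neg {σ : Finset ι} {b : ι → (Fin d → ℝ) →ᵃ[ℝ] ℝ} {x : Fin d → ℝ} {i : ι}
    (hi : i ∈ σ) (h : b i x < 0) : weight σ b x = 0 := by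
  rw [weight, if_neg fun h' => absurd (h' i hi) h.not_gt,
    if_neg fun h' => absurd (h' i hi) h.not_ge]

theorem weight_nonneg (σ : Finset ι) (b : ι → (Fin d → ℝ) →ᵃ[ℝ] ℝ) (x : Fin d → ℝ) :
    0 ≤ weight σ b x := by
  unfold weight; split_ifs <;> norm_num

theorem eventually_pos {p : Fin d → ℝ} {f : (Fin d → ℝ) →ᵃ[ℝ] ℝ} (h : 0 < f p) :
    ∀ᶠ x in 𝓝 p, 0 < f x :=
  (f.continuous_of_finiteDimensional.tendsto p).eventually (lt_mem_nhds h)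

theorem eventually_neg {p : Fin d → ℝ} {f : (Fin d → ℝ) →ᵃ[ℝ] ℝ} (h : f p < 0) :
    ∀ᶠ x in 𝓝 p, f x < 0 :=
  (f.continuous_of_finiteDimensional.tendsto p).eventually (gt_mem_nhds h)

variable [DecidableEq ι]

/-- The ridges of cells of `S` that meet `U` are shared by exactly two cells, on opposite sides. -/
def CrossesProperly (A : ι → Fin d → ℝ) (S : Finset (Finset ι))
    (b : Finset ι → ι → (Fin d → ℝ) →ᵃ[ℝ] ℝ) (U : Set (Fin d → ℝ)) : Prop :=
  ∀ σ ∈ S, ∀ i ∈ σ, ∀ x ∈ U, b σ i x = 0 → (∀ k ∈ σ, k ≠ i → 0 < b σ k x) →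
    ∃ j, j ∉ σ ∧ insert j (σ.erase i) ∈ S ∧ b σ i (A j) < 0 ∧
      ∀ τ ∈ S, σ.erase i ⊆ τ → τ = σ ∨ τ = insert j (σ.erase i)

/-- R consists of the cells that have p in the relative interior of a facet. Passing to the
neighbour across that facet is an involution without fixed points on R, and the two facet
coordinates differ by a negative factor, so their signs cancel in pairs at every x. -/
theorem sum_sign_eq_zero {A : ι → Fin d → ℝ} {S : Finset (Finset ι)}
    {b : Finset ι → ι → (Fin d → ℝ) →ᵃ[ℝ] ℝ} {U : Set (Fin d → ℝ)}
    (hb : ∀ σ ∈ S, IsBary A σ (b σ)) (hS : CrossesProperly A S b U)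
    {p : Fin d → ℝ} (hpU : p ∈ U) (R : Finset (Finset ι)) (v : Finset ι → ι)
    (hR : ∀ σ, σ ∈ R ↔ σ ∈ S ∧ ∃ i ∈ σ, b σ i p = 0 ∧ ∀ k ∈ σ, k ≠ i → 0 < b σ k p)
    (hv : ∀ σ ∈ R, v σ ∈ σ ∧ b σ (v σ) p = 0 ∧ ∀ k ∈ σ, k ≠ v σ → 0 < b σ k p)
    (x : Fin d → ℝ) :
    ∑ σ ∈ R, ((SignType.sign (b σ (v σ) x) : SignType) : ℤ) = 0 := by
  have hRS : ∀ σ ∈ R, σ ∈ S := fun σ hσ => ((hR σ).1 hσ).1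
  have huniq : ∀ σ ∈ R, ∀ i ∈ σ, b σ i p = 0 → i = v σ := fun σ hσ i hi h0 => by
    by_contra hne
    exact ((hv σ hσ).2.2 i hi hne).ne' h0
  have hnb : ∀ σ (hσ : σ ∈ R), ∃ j, j ∉ σ ∧ insert j (σ.erase (v σ)) ∈ S ∧
      b σ (v σ) (A j) < 0 ∧
      ∀ τ ∈ S, σ.erase (v σ) ⊆ τ → τ = σ ∨ τ = insert j (σ.erase (v σ)) := fun σ hσ =>
    hS σ (hRS σ hσ) _ (hv σ hσ).1 p hpU (hv σ hσ).2.1 (hv σ hσ).2.2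
  -- The value of v at ∅ only serves to show that there are labels, as `choose!` needs a default.
  have : Nonempty ι := ⟨v ∅⟩
  choose! n hnσ hnS hnneg hnall using hnb
  have hmem : ∀ σ ∈ R, insert (n σ) (σ.erase (v σ)) ∈ R ∧
      v (insert (n σ) (σ.erase (v σ))) = n σ := by
    intro σ hσ
    have hrel := (hb σ (hRS σ hσ)).eq_of_insert (hnσ σ hσ) (hb _ (hnS σ hσ)) p
    have h0 : b (insert (n σ) (σ.erase (v σ))) (n σ) p = 0 := by
      have := hrel.1 (hv σ hσ).1
      rw [(hv σ hσ).2.1] at this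
      rcases mul_eq_zero.1 this.symm with h | h
      · exact h
      · exact absurd h (hnneg σ hσ).ne
    have hpos : ∀ k ∈ insert (n σ) (σ.erase (v σ)), k ≠ n σ →
        0 < b (insert (n σ) (σ.erase (v σ))) k p := by
      intro k hk hkn
      have hk' := Finset.mem_of_mem_insert_of_ne hk hkn
      have := hrel.2 k hk'
      rw [h0, zero_mul, add_zero] at this
      rw [← this]
      exact (hv σ hσ).2.2 k (Finset.mem_of_mem_erase hk') (Finset.ne_of_mem_erase hk')
    have hin : insert (n σ) (σ.erase (v σ)) ∈ R :=
      (hR _).2 ⟨hnS σ hσ, n σ, Finset.mem_insert_self _ _, h0, hpos⟩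
    exact ⟨hin, (huniq _ hin _ (Finset.mem_insert_self _ _) h0).symm⟩
  refine Finset.sum_involution (fun σ _ => insert (n σ) (σ.erase (v σ))) ?_ ?_ ?_ ?_
  · intro σ hσ
    rw [(hmem σ hσ).2]
    have hrel := ((hb σ (hRS σ hσ)).eq_of_insert (hnσ σ hσ) (hb _ (hnS σ hσ)) x).1 (hv σ hσ).1
    rw [hrel, sign_mul, sign_neg (hnneg σ hσ)]
    generalize SignType.sign (b (insert (n σ) (σ.erase (v σ))) (n σ) x) = s
    cases s <;> rfl
  · intro σ hσ _ heq
    exact hnσ σ hσ ((Finset.ext_iff.1 heq _).1 (Finset.mem_insert_self _ _))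
  · exact fun σ hσ => (hmem σ hσ).1
  · intro σ hσ
    have hτ := hmem σ hσ
    have hn' : n σ ∉ σ.erase (v σ) := fun h => hnσ σ hσ (Finset.mem_of_mem_erase h)
    have hsub : (insert (n σ) (σ.erase (v σ))).erase (v (insert (n σ) (σ.erase (v σ)))) ⊆ σ := by
      rw [hτ.2, Finset.erase_insert hn']
      exact Finset.erase_subset _ _
    rcases hnall _ hτ.1 σ (hRS σ hσ) hsub with h | h
    · exact absurd ((Finset.ext_iff.1 h _).2 (Finset.mem_insert_self _ _)) (hnσ σ hσ)
    · exact h.symm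

/-- By `hp`, p lies on at most one facet hyperplane of each cell. A cell outside R therefore has p
in its interior or strictly outside, and its weight is locally constant. A cell in R has weight 1
plus the sign of its facet coordinate near p, and these signs sum to zero. -/
theorem eventually_cellCount_eq {A : ι → Fin d → ℝ} {S : Finset (Finset ι)}
    {b : Finset ι → ι → (Fin d → ℝ) →ᵃ[ℝ] ℝ} {U : Set (Fin d → ℝ)}
    (hb : ∀ σ ∈ S, IsBary A σ (b σ)) (hS : CrossesProperly A S b U)
    {p : Fin d → ℝ} (hpU : p ∈ U)
    (hp : ∀ σ ∈ S, ∀ i ∈ σ, ∀ k ∈ σ, b σ i p = 0 → b σ k p = 0 → i = k) :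
    ∀ᶠ x in 𝓝 p, cellCount S b x = cellCount S b p := by
  classical
  set R := S.filter fun σ => ∃ i ∈ σ, b σ i p = 0 ∧ ∀ k ∈ σ, k ≠ i → 0 < b σ k p with hRdef
  have hR : ∀ σ, σ ∈ R ↔ σ ∈ S ∧ ∃ i ∈ σ, b σ i p = 0 ∧ ∀ k ∈ σ, k ≠ i → 0 < b σ k p :=
    fun σ => Finset.mem_filter
  have hv' : ∀ σ ∈ R, ∃ i, i ∈ σ ∧ b σ i p = 0 ∧ ∀ k ∈ σ, k ≠ i → 0 < b σ k p :=
    fun σ hσ => ((hR σ).1 hσ).2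
  have hι : ∀ σ ∈ R, Nonempty ι := fun σ hσ => ⟨(hv' σ hσ).choose⟩
  by_cases hne : Nonempty ι
  swap
  · have : S = ∅ := by
      by_contra h
      obtain ⟨σ, hσ⟩ := Finset.nonempty_of_ne_empty h
      exact hne ⟨(hb σ hσ).nonempty.choose⟩
    simp [cellCount, this]
  choose! v hv using hv'
  have hsum := sum_sign_eq_zero hb hS hpU R v hR hv
  have hsplit : ∀ x, cellCount S b x =
      ∑ σ ∈ S.filter (fun σ => σ ∉ R), weight σ (b σ) x + ∑ σ ∈ R, weight σ (b σ) x := by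
    intro x
    rw [cellCount, ← Finset.sum_filter_add_sum_filter_not S (fun σ => σ ∉ R)]
    congr 2
    ext σ
    simp only [Finset.mem_filter, not_not]
    exact ⟨fun h => h.2, fun h => ⟨((hR σ).1 h).1, h⟩⟩
  have h1 : ∀ᶠ x in 𝓝 p, ∀ σ ∈ S.filter (fun σ => σ ∉ R),
      weight σ (b σ) x = weight σ (b σ) p := by
    rw [Filter.eventually_all_finset]
    intro σ hσ
    rw [Finset.mem_filter] at hσ
    obtain ⟨hσS, hσR⟩ := hσ
    by_cases hneg : ∃ i ∈ σ, b σ i p < 0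
    · obtain ⟨i, hi, hlt⟩ := hneg
      filter_upwards [eventually_neg hlt] with x hx
      rw [weight_of_neg hi hx, weight_of_neg hi hlt]
    · push Not at hneg
      have hpos : ∀ i ∈ σ, 0 < b σ i p := by
        intro i hi
        refine lt_of_le_of_ne (hneg i hi) fun h0 => hσR ((hR σ).2 ⟨hσS, i, hi, h0.symm, ?_⟩)
        intro k hk hki
        exact lt_of_le_of_ne (hneg k hk) fun hk0 => hki (hp σ hσS k hk i hi hk0.symm h0.symm)
      have : ∀ᶠ x in 𝓝 p, ∀ i ∈ σ, 0 < b σ i x := by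
        rw [Filter.eventually_all_finset]
        exact fun i hi => eventually_pos (hpos i hi)
      filter_upwards [this] with x hx
      rw [weight_of_pos hx, weight_of_pos hpos]
  have h2 : ∀ᶠ x in 𝓝 p, ∀ σ ∈ R,
      weight σ (b σ) x = 1 + ((SignType.sign (b σ (v σ) x) : SignType) : ℤ) := by
    rw [Filter.eventually_all_finset]
    intro σ hσ
    have : ∀ᶠ x in 𝓝 p, ∀ k ∈ σ, k ≠ v σ → 0 < b σ k x := by
      rw [Filter.eventually_all_finset]
      intro k hk
      by_cases hkv : k = v σ
      · simp [hkv]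
      · filter_upwards [eventually_pos ((hv σ hσ).2.2 k hk hkv)] with x hx _ using hx
    filter_upwards [this] with x hx
    rcases lt_trichotomy (b σ (v σ) x) 0 with hlt | h0 | hgt
    · rw [weight_of_neg (hv σ hσ).1 hlt, sign_neg hlt]; rfl
    · rw [weight, if_neg fun h => (h _ (hv σ hσ).1).ne' h0, if_pos, h0, sign_zero]
      · rfl
      · intro k hk
        by_cases hkv : k = v σ
        · rw [hkv, h0]
        · exact (hx k hk hkv).le
    · rw [weight_of_pos, sign_pos hgt]
      · rfl
      · intro k hk
        by_cases hkv : k = v σ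
        · rw [hkv]; exact hgt
        · exact hx k hk hkv
  have h3 := h2.self_of_nhds
  filter_upwards [h1, h2] with x hx1 hx2
  rw [hsplit, hsplit, Finset.sum_congr rfl hx1, Finset.sum_congr rfl hx2,
    Finset.sum_congr rfl h3, Finset.sum_add_distrib, Finset.sum_add_distrib, hsum, hsum]

theorem cellCount_eq {A : ι → Fin d → ℝ} {S : Finset (Finset ι)}
    {b : Finset ι → ι → (Fin d → ℝ) →ᵃ[ℝ] ℝ} {U : Set (Fin d → ℝ)}
    (hb : ∀ σ ∈ S, IsBary A σ (b σ)) (hS : CrossesProperly A S b U)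
    (hU : IsOpen U) (hUc : Convex ℝ U) {x y : Fin d → ℝ} (hx : x ∈ U) (hy : y ∈ U)
    (hx0 : ∀ σ ∈ S, ∀ i ∈ σ, b σ i x ≠ 0) (hy0 : ∀ σ ∈ S, ∀ i ∈ σ, b σ i y ≠ 0) :
    cellCount S b x = cellCount S b y := by
  have hy1 : ∀ᶠ z in 𝓝 y, cellCount S b z = cellCount S b y :=
    eventually_cellCount_eq hb hS hy fun σ hσ i hi _ _ h => absurd h (hy0 σ hσ i hi)
  obtain ⟨V, hV, hVo, hyV⟩ := eventually_nhds_iff.1 (hy1.and (hU.mem_nhds hy))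
  -- If the i-th and k-th coordinates vanish at a common point of the line from x to z, this
  -- combination vanishes at z. It is not identically zero: its value at A k is the i-th coordinate
  -- of x.
  obtain ⟨z, hzV, hz⟩ := exists_mem_open_ne_zero
    (S.sigma fun σ => (σ ×ˢ σ).filter fun q => q.1 ≠ q.2)
    (fun q => (b q.1 q.2.1 x) • b q.1 q.2.2 - (b q.1 q.2.2 x) • b q.1 q.2.1)
    (by
      rintro ⟨σ, i, k⟩ hq
      simp only [Finset.mem_sigma, Finset.mem_filter, Finset.mem_product] at hq
      obtain ⟨hσ, ⟨hi, hk⟩, hik⟩ := hq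
      refine ⟨A k, ?_⟩
      simp [(hb σ hσ).apply_same k hk, (hb σ hσ).apply_ne i hi k hk hik, hx0 σ hσ i hi])
    hVo ⟨y, hyV⟩
  rw [← (hV z hzV).1]
  have hseg : segment ℝ x z ⊆ U := hUc.segment_subset hx (hV z hzV).2
  refine (convex_segment x z).isPreconnected.constant (f := cellCount S b) ?_
    (left_mem_segment ℝ x z) (right_mem_segment ℝ x z)
  intro p hp
  refine ContinuousAt.continuousWithinAt ?_
  have : ∀ᶠ q in 𝓝 p, cellCount S b q = cellCount S b p := by
    refine eventually_cellCount_eq hb hS (hseg hp) fun σ hσ i hi k hk hi0 hk0 => ?_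
    by_contra hik
    rw [segment_eq_image_lineMap] at hp
    obtain ⟨ε, _, rfl⟩ := hp
    rw [affineMap_lineMap] at hi0 hk0
    refine hz ⟨σ, i, k⟩ ?_ ?_
    · simp [hσ, hi, hk, hik]
    · have hε : ε ≠ 0 := by
        rintro rfl
        simp at hi0
        exact hx0 σ hσ i hi hi0
      have : ε * (b σ i x * b σ k z - b σ k x * b σ i z) = 0 := by
        linear_combination b σ i x * hk0 - b σ k x * hi0
      rcases mul_eq_zero.1 this with h | h
      · exact absurd h hε
      · simpa using h
  exact (tendsto_congr' this).2 tendsto_const_nhds |>.congr' (by simp)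

end Criterion

/-! ### The ridge criterion for triangulations -/

section Criterion

variable {ι : Type*} {d : ℕ}

theorem exists_lineMap_mem {V : Set (Fin d → ℝ)} (hV : IsOpen V) {x : Fin d → ℝ} (hx : x ∈ V)
    (c : Fin d → ℝ) : ∃ ε : ℝ, 0 < ε ∧ ε < 1 ∧ AffineMap.lineMap x c ε ∈ V := by
  have hcont : Tendsto (fun ε : ℝ => (AffineMap.lineMap x c ε : Fin d → ℝ)) (𝓝[>] 0) (𝓝 x) := by
    have h1 : Continuous fun ε : ℝ => (AffineMap.lineMap x c ε : Fin d → ℝ) :=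
      AffineMap.lineMap_continuous
    have := h1.tendsto 0
    rw [AffineMap.lineMap_apply_zero] at this
    exact this.mono_left nhdsWithin_le_nhds
  obtain ⟨ε, ⟨hε, h0⟩, h1⟩ := ((hcont.eventually (hV.mem_nhds hx)).and
    self_mem_nhdsWithin |>.and (Ioo_mem_nhdsGT (zero_lt_one' ℝ))).exists
  exact ⟨ε, h1.1, h1.2, hε⟩

theorem weight_of_notMem {A : ι → Fin d → ℝ} {σ : Finset ι} {b : ι → (Fin d → ℝ) →ᵃ[ℝ] ℝ}
    (h : IsBary A σ b) {x : Fin d → ℝ} (hx : x ∉ conv A σ) : weight σ b x = 0 := by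
  rw [h.mem_conv_iff] at hx
  push Not at hx
  obtain ⟨i, hi, hlt⟩ := hx
  exact weight_of_neg hi hlt

theorem conv_subset_hull (A : ι → Fin d → ℝ) (σ : Finset ι) :
    conv A σ ⊆ convexHull ℝ (Set.range A) :=
  convexHull_mono (Set.image_subset_range _ _)

theorem isOpen_pos (σ : Finset ι) (b : ι → (Fin d → ℝ) →ᵃ[ℝ] ℝ) :
    IsOpen {x | ∀ i ∈ σ, 0 < b i x} := by
  have : {x | ∀ i ∈ σ, 0 < b i x} = ⋂ i ∈ σ, {x | 0 < b i x} := by ext; simp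
  rw [this]
  exact isOpen_biInter_finset fun i _ =>
    isOpen_lt continuous_const (b i).continuous_of_finiteDimensional

variable [DecidableEq ι]

/-- A ridge of `T` that is contained in one cell only, with all other points on the same side. -/
def IsBoundaryRidge (A : ι → Fin d → ℝ) (T : Finset (Finset ι))
    (b : Finset ι → ι → (Fin d → ℝ) →ᵃ[ℝ] ℝ) (σ : Finset ι) (i : ι) : Prop :=
  (∀ j, j ∉ σ → 0 < b σ i (A j)) ∧ ∀ τ ∈ T, σ.erase i ⊆ τ → τ = σ

/-- A ridge of `T` that is shared by exactly two cells, which lie on opposite sides. -/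
def IsInteriorRidge (A : ι → Fin d → ℝ) (T : Finset (Finset ι))
    (b : Finset ι → ι → (Fin d → ℝ) →ᵃ[ℝ] ℝ) (σ : Finset ι) (i : ι) : Prop :=
  ∃ j, j ∉ σ ∧ insert j (σ.erase i) ∈ T ∧ b σ i (A j) < 0 ∧
    ∀ τ ∈ T, σ.erase i ⊆ τ → τ = σ ∨ τ = insert j (σ.erase i)

/-- A collection of simplices each ridge of which is an interior or a boundary ridge. -/
structure IsPseudoManifold (A : ι → Fin d → ℝ) (T : Finset (Finset ι))
    (b : Finset ι → ι → (Fin d → ℝ) →ᵃ[ℝ] ℝ) : Prop where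
  bary : ∀ σ ∈ T, IsBary A σ (b σ)
  ridge : ∀ σ ∈ T, ∀ i ∈ σ, IsInteriorRidge A T b σ i ∨ IsBoundaryRidge A T b σ i
  exists_boundary : ∃ σ ∈ T, ∃ i ∈ σ, (σ.erase i).Nonempty ∧ IsBoundaryRidge A T b σ i

/-- The intersection of the open half-spaces given by the boundary ridges. -/
def innerRegion (A : ι → Fin d → ℝ) (T : Finset (Finset ι))
    (b : Finset ι → ι → (Fin d → ℝ) →ᵃ[ℝ] ℝ) : Set (Fin d → ℝ) :=
  {x | ∀ σ ∈ T, ∀ i ∈ σ, IsBoundaryRidge A T b σ i → 0 < b σ i x}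

namespace IsPseudoManifold

variable {A : ι → Fin d → ℝ} {T : Finset (Finset ι)} {b : Finset ι → ι → (Fin d → ℝ) →ᵃ[ℝ] ℝ}

theorem isOpen_innerRegion : IsOpen (innerRegion A T b) := by
  classical
  have : innerRegion A T b = ⋂ σ ∈ T, {x | ∀ i ∈ σ.filter (IsBoundaryRidge A T b σ),
      0 < b σ i x} := by
    ext x; simp [innerRegion, Finset.mem_filter]
  rw [this]
  exact isOpen_biInter_finset fun σ _ => isOpen_pos _ _

theorem convex_innerRegion : Convex ℝ (innerRegion A T b) := by
  have : innerRegion A T b = ⋂ (σ ∈ T) (i ∈ σ) (_ : IsBoundaryRidge A T b σ i),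
      {x | 0 < b σ i x} := by
    ext x; simp [innerRegion]
  rw [this]
  exact convex_iInter₂ fun σ _ => convex_iInter₂ fun i _ => convex_iInter fun _ =>
    (convex_Ioi (0 : ℝ)).affine_preimage (b σ i)

theorem apply_nonneg (h : IsPseudoManifold A T b) {σ : Finset ι} (hσ : σ ∈ T) {i : ι}
    (hi : i ∈ σ) (hB : IsBoundaryRidge A T b σ i) (k : ι) :
    0 ≤ b σ i (A k) ∧ (k ∉ σ.erase i → 0 < b σ i (A k)) := by
  by_cases hk : k ∈ σ
  · by_cases hki : k = i
    · subst hki; simp [(h.bary σ hσ).apply_same k hi]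
    · rw [(h.bary σ hσ).apply_ne i hi k hk (Ne.symm hki)]
      exact ⟨le_rfl, fun h' => absurd (Finset.mem_erase.2 ⟨hki, hk⟩) h'⟩
  · exact ⟨(hB.1 k hk).le, fun _ => hB.1 k hk⟩

/-- A boundary functional is non-negative at all points of A and vanishes only at the vertices of
its ridge, so it is positive wherever a point outside the ridge has positive weight. -/
theorem mem_innerRegion (h : IsPseudoManifold A T b) {τ : Finset ι} (hτ : τ ∈ T)
    {x : Fin d → ℝ} (hx : ∀ i ∈ τ, 0 < b τ i x) : x ∈ innerRegion A T b := by
  intro σ hσ i hi hB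
  rw [(h.bary τ hτ).map_eq (b σ i) x]
  -- If all vertices of τ were in the ridge, the functional would vanish identically, although it is
  -- 1 at A i.
  have hex : ∃ k ∈ τ, k ∉ σ.erase i := by
    by_contra hno
    push Not at hno
    have h1 := (h.bary σ hσ).apply_same i hi
    rw [(h.bary τ hτ).map_eq (b σ i) (A i), Finset.sum_eq_zero] at h1
    · exact zero_ne_one h1
    · intro k hk
      have := Finset.mem_erase.1 (hno k hk)
      rw [(h.bary σ hσ).apply_ne i hi k this.2 this.1.symm, mul_zero]
  obtain ⟨k, hk, hkσ⟩ := hex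
  refine Finset.sum_pos' (fun m hm => mul_nonneg (hx m hm).le (h.apply_nonneg hσ hi hB m).1)
    ⟨k, hk, mul_pos (hx k hk) ((h.apply_nonneg hσ hi hB k).2 hkσ)⟩

theorem lineMap_mem_innerRegion (h : IsPseudoManifold A T b) {x c : Fin d → ℝ}
    (hx : x ∈ convexHull ℝ (Set.range A)) (hc : c ∈ innerRegion A T b) {ε : ℝ} (h0 : 0 < ε)
    (h1 : ε < 1) : AffineMap.lineMap x c ε ∈ innerRegion A T b := by
  intro σ hσ i hi hB
  have hx0 : 0 ≤ b σ i x := by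
    have hconv : Convex ℝ {y | 0 ≤ b σ i y} := (convex_Ici (0 : ℝ)).affine_preimage (b σ i)
    refine convexHull_min ?_ hconv hx
    rintro _ ⟨k, rfl⟩
    exact (h.apply_nonneg hσ hi hB k).1
  rw [affineMap_lineMap]
  have := mul_pos h0 (hc σ hσ i hi hB)
  have := mul_nonneg (sub_nonneg.2 h1.le) hx0
  linarith

theorem crossesProperly (h : IsPseudoManifold A T b) :
    CrossesProperly A T b (innerRegion A T b) := by
  intro σ hσ i hi x hx h0 _
  rcases h.ridge σ hσ i hi with hI | hB
  · exact hI
  · exact absurd h0 (hx σ hσ i hi hB).ne'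

theorem exists_generic (h : IsPseudoManifold A T b) {V : Set (Fin d → ℝ)} (hV : IsOpen V)
    (hne : V.Nonempty) : ∃ y ∈ V, ∀ σ ∈ T, ∀ i ∈ σ, b σ i y ≠ 0 := by
  obtain ⟨y, hy, hy0⟩ := exists_mem_open_ne_zero (T.sigma fun σ => σ) (fun q => b q.1 q.2)
    (by
      rintro ⟨σ, i⟩ hq
      rw [Finset.mem_sigma] at hq
      exact ⟨A i, by simp [(h.bary σ hq.1).apply_same i hq.2]⟩) hV hne
  exact ⟨y, hy, fun σ hσ i hi => hy0 ⟨σ, i⟩ (Finset.mem_sigma.2 ⟨hσ, hi⟩)⟩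

theorem exists_interior (h : IsPseudoManifold A T b) {σ : Finset ι} (hσ : σ ∈ T) :
    ∃ c : Fin d → ℝ, ∀ i ∈ σ, 0 < b σ i c :=
  let ⟨z, hz, _⟩ := (h.bary σ hσ).exists_pos subset_rfl (h.bary σ hσ).nonempty
  ⟨z, hz⟩

/-- Near a relative interior point z of a boundary ridge only the cell σ is present. A slight move
from z into σ gives a generic point that is counted once, that is, with weight 2. -/
theorem exists_cellCount_eq_two (h : IsPseudoManifold A T b) :
    ∃ y ∈ innerRegion A T b, (∀ σ ∈ T, ∀ i ∈ σ, b σ i y ≠ 0) ∧ cellCount T b y = 2 := by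
  obtain ⟨σ, hσ, i, hi, hne, hB⟩ := h.exists_boundary
  have hbσ := h.bary σ hσ
  obtain ⟨z, hz, hz0⟩ := hbσ.exists_pos (Finset.erase_subset i σ) hne
  obtain ⟨c, hc⟩ := h.exists_interior hσ
  have hzi : b σ i z = 0 := hz0 i hi (Finset.notMem_erase i σ)
  -- Since the ridge functional vanishes at z, a cell through z represents z by vertices of the
  -- ridge alone. All coordinates of z on the ridge are positive, so the cell contains the whole
  -- ridge and equals σ.
  have hout : ∀ τ ∈ T, τ ≠ σ → z ∉ conv A τ := by
    intro τ hτ hτσ hzτ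
    have hw := (h.bary τ hτ).mem_conv_iff.1 hzτ
    refine hτσ (hB.2 τ hτ fun k hk => ?_)
    by_contra hkτ
    have hzero : ∀ m ∈ τ, b τ m z * b σ i (A m) = 0 := by
      have := (h.bary τ hτ).map_eq (b σ i) z
      rw [hzi] at this
      exact (Finset.sum_eq_zero_iff_of_nonneg fun m hm =>
        mul_nonneg (hw m hm) (h.apply_nonneg hσ hi hB m).1).1 this.symm
    have hk0 := (h.bary τ hτ).map_eq (b σ k) z
    rw [Finset.sum_eq_zero] at hk0
    · exact (hz k hk).ne' hk0
    · intro m hm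
      by_cases hmσ : m ∈ σ.erase i
      · rw [hbσ.apply_ne k (Finset.mem_of_mem_erase hk) m (Finset.mem_of_mem_erase hmσ)
          (by rintro rfl; exact hkτ hm), mul_zero]
      · rcases mul_eq_zero.1 (hzero m hm) with h' | h'
        · rw [h', zero_mul]
        · exact absurd h' ((h.apply_nonneg hσ hi hB m).2 hmσ).ne'
  set V : Set (Fin d → ℝ) := {x | ∀ k ∈ σ.erase i, 0 < b σ k x} ∩
    ⋂ τ ∈ T.erase σ, (conv A τ)ᶜ with hVdef
  have hVo : IsOpen V := (isOpen_pos _ _).inter <| isOpen_biInter_finset fun τ hτ =>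
    (h.bary τ (Finset.mem_of_mem_erase hτ)).isClosed_conv.isOpen_compl
  have hzV : z ∈ V := ⟨hz, Set.mem_iInter₂.2 fun τ hτ =>
    hout τ (Finset.mem_of_mem_erase hτ) (Finset.ne_of_mem_erase hτ)⟩
  obtain ⟨ε, h0, _, hεV⟩ := exists_lineMap_mem hVo hzV c
  have hWne : (V ∩ {x | 0 < b σ i x}).Nonempty := by
    refine ⟨_, hεV, ?_⟩
    have := mul_pos h0 (hc i hi)
    rw [Set.mem_ofPred_eq, affineMap_lineMap, hzi, mul_zero, zero_add]
    exact this
  obtain ⟨y, ⟨hyV, hyi⟩, hy0⟩ := h.exists_generic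
    (hVo.inter (isOpen_lt continuous_const (b σ i).continuous_of_finiteDimensional)) hWne
  have hyσ : ∀ k ∈ σ, 0 < b σ k y := by
    intro k hk
    by_cases hki : k = i
    · rw [hki]; exact hyi
    · exact hyV.1 k (Finset.mem_erase.2 ⟨hki, hk⟩)
  refine ⟨y, h.mem_innerRegion hσ hyσ, hy0, ?_⟩
  rw [cellCount, Finset.sum_eq_single σ]
  · exact weight_of_pos hyσ
  · intro τ hτ hτσ
    exact weight_of_notMem (h.bary τ hτ)
      (Set.mem_iInter₂.1 hyV.2 τ (Finset.mem_erase.2 ⟨hτσ, hτ⟩))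
  · exact fun h' => absurd hσ h'

theorem cellCount_eq_two (h : IsPseudoManifold A T b) {y : Fin d → ℝ}
    (hy : y ∈ innerRegion A T b) (hy0 : ∀ σ ∈ T, ∀ i ∈ σ, b σ i y ≠ 0) :
    cellCount T b y = 2 := by
  obtain ⟨x, hx, hx0, hx2⟩ := h.exists_cellCount_eq_two
  rw [← hx2]
  exact cellCount_eq h.bary h.crossesProperly isOpen_innerRegion convex_innerRegion hy hx hy0 hx0

/-- Near an uncovered point of the hull there would be a generic point of the inner region with
count 0 instead of 2. -/
theorem cover (h : IsPseudoManifold A T b) :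
    ⋃ σ ∈ T, conv A σ = convexHull ℝ (Set.range A) := by
  refine Set.Subset.antisymm (Set.iUnion₂_subset fun σ _ => conv_subset_hull A σ) ?_
  intro x hx
  by_contra hxu
  have hcl : IsClosed (⋃ σ ∈ T, conv A σ) :=
    T.finite_toSet.isClosed_biUnion fun σ hσ => (h.bary σ hσ).isClosed_conv
  obtain ⟨c, hc, _⟩ := h.exists_cellCount_eq_two
  obtain ⟨ε, h0, h1, hε⟩ := exists_lineMap_mem hcl.isOpen_compl hxu c
  obtain ⟨y, ⟨hyu, hyU⟩, hy0⟩ := h.exists_generic (hcl.isOpen_compl.inter isOpen_innerRegion)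
    ⟨_, hε, h.lineMap_mem_innerRegion hx hc h0 h1⟩
  have h2 := h.cellCount_eq_two hyU hy0
  rw [cellCount, Finset.sum_eq_zero] at h2
  · norm_num at h2
  · intro σ hσ
    exact weight_of_notMem (h.bary σ hσ) fun hmem => hyu (Set.mem_iUnion₂.2 ⟨σ, hσ, hmem⟩)

/-- Let F be the set of vertices that carry z in σ, and S the star of F. Near z the count of S alone
is constant, and close to z inside σ it is at least 2. It is thus at least 2 close to z inside τ as
well, where the count of all of T is exactly 2; this forces τ ∈ S, that is, F ⊆ τ. -/
theorem mem_of_pos (h : IsPseudoManifold A T b) {σ τ : Finset ι} (hσ : σ ∈ T) (hτ : τ ∈ T)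
    {z : Fin d → ℝ} (hzσ : z ∈ conv A σ) (hzτ : z ∈ conv A τ) {i : ι} (hi : i ∈ σ)
    (hpos : 0 < b σ i z) : i ∈ τ := by
  classical
  set F := σ.filter fun k => 0 < b σ k z with hF
  suffices hFτ : F ⊆ τ from hFτ (Finset.mem_filter.2 ⟨hi, hpos⟩)
  have hbσ := h.bary σ hσ
  set S := T.filter fun ρ => F ⊆ ρ with hS
  have hST : ∀ ρ ∈ S, ρ ∈ T := fun ρ hρ => (Finset.mem_filter.1 hρ).1
  have hbS : ∀ ρ ∈ S, IsBary A ρ (b ρ) := fun ρ hρ => h.bary ρ (hST ρ hρ)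
  have hposS : ∀ ρ ∈ S, ∀ k ∈ F, 0 < b ρ k z := by
    intro ρ hρ k hk
    have hFρ := (Finset.mem_filter.1 hρ).2
    rw [hbσ.map_eq (b ρ k) z]
    refine Finset.sum_pos' (fun m hm => ?_) ⟨k, (Finset.mem_filter.1 hk).1, ?_⟩
    · by_cases hmF : m ∈ F
      · by_cases hmk : m = k
        · subst hmk
          rw [(hbS ρ hρ).apply_same m (hFρ hmF), mul_one]
          exact (Finset.mem_filter.1 hmF).2.le
        · rw [(hbS ρ hρ).apply_ne k (hFρ hk) m (hFρ hmF) (Ne.symm hmk), mul_zero]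
      · have : b σ m z = 0 := by
          refine le_antisymm (not_lt.1 fun h' => hmF (Finset.mem_filter.2 ⟨hm, h'⟩)) ?_
          exact hbσ.mem_conv_iff.1 hzσ m hm
        rw [this, zero_mul]
    · rw [(hbS ρ hρ).apply_same k (hFρ hk), mul_one]
      exact (Finset.mem_filter.1 hk).2
  have hev : ∀ᶠ x in 𝓝 z, ∀ ρ ∈ S, ∀ k ∈ F, 0 < b ρ k x := by
    simp only [Filter.eventually_all_finset]
    exact fun ρ hρ k hk => eventually_pos (hposS ρ hρ k hk)
  obtain ⟨r, hr, hball⟩ := Metric.eventually_nhds_iff_ball.1 hev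
  set U := innerRegion A T b ∩ Metric.ball z r with hU
  have hUo : IsOpen U := isOpen_innerRegion.inter Metric.isOpen_ball
  have hUc : Convex ℝ U := convex_innerRegion.inter (convex_ball z r)
  have hcross : CrossesProperly A S b U := by
    intro ρ hρ k hk x hx h0 _
    rcases h.ridge ρ (hST ρ hρ) k hk with ⟨j, hj, hjT, hneg, hall⟩ | hB
    · refine ⟨j, hj, Finset.mem_filter.2 ⟨hjT, fun m hm => ?_⟩, hneg,
        fun ρ' hρ' => hall ρ' (hST ρ' hρ')⟩
      -- The coordinates of F are positive throughout the ball, so crossing a ridge there never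
      -- drops a vertex of F.
      refine Finset.mem_insert_of_mem (Finset.mem_erase.2 ⟨?_, (Finset.mem_filter.1 hρ).2 hm⟩)
      rintro rfl
      exact (hball x hx.2 ρ hρ m hm).ne' h0
    · exact absurd h0 (hx.1 ρ (hST ρ hρ) k hk hB).ne'
  have hnear : ∀ ρ ∈ T, z ∈ conv A ρ → ∃ y ∈ U, (∀ τ ∈ T, ∀ i ∈ τ, b τ i y ≠ 0) ∧
      weight ρ (b ρ) y = 2 := by
    intro ρ hρ hzρ
    obtain ⟨c, hc⟩ := h.exists_interior hρ
    obtain ⟨ε, h0, h1, hε⟩ := exists_lineMap_mem (Metric.isOpen_ball (x := z) (ε := r))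
      (Metric.mem_ball_self hr) c
    have hposε : ∀ k ∈ ρ, 0 < b ρ k (AffineMap.lineMap z c ε) := by
      intro k hk
      rw [affineMap_lineMap]
      have := mul_pos h0 (hc k hk)
      have := mul_nonneg (sub_nonneg.2 h1.le) ((h.bary ρ hρ).mem_conv_iff.1 hzρ k hk)
      linarith
    obtain ⟨y, ⟨hyU, hyρ⟩, hy0⟩ := h.exists_generic (hUo.inter (isOpen_pos ρ (b ρ)))
      ⟨_, ⟨h.mem_innerRegion hρ hposε, hε⟩, hposε⟩
    exact ⟨y, hyU, hy0, weight_of_pos hyρ⟩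
  have hσS : σ ∈ S := Finset.mem_filter.2 ⟨hσ, Finset.filter_subset _ _⟩
  obtain ⟨y₁, hy₁U, hy₁0, hy₁⟩ := hnear σ hσ hzσ
  obtain ⟨y₂, hy₂U, hy₂0, hy₂⟩ := hnear τ hτ hzτ
  have h1 : 2 ≤ cellCount S b y₁ := by
    rw [← hy₁]
    exact Finset.single_le_sum (fun ρ _ => weight_nonneg ρ (b ρ) y₁) hσS
  have h2 : cellCount S b y₁ = cellCount S b y₂ :=
    cellCount_eq hbS hcross hUo hUc hy₁U hy₂U (fun ρ hρ => hy₁0 ρ (hST ρ hρ))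
      fun ρ hρ => hy₂0 ρ (hST ρ hρ)
  have h3 := h.cellCount_eq_two hy₂U.1 hy₂0
  by_contra hFτ
  have hτS : τ ∉ S := fun h' => hFτ (Finset.mem_filter.1 h').2
  have h4 : cellCount S b y₂ + weight τ (b τ) y₂ ≤ cellCount T b y₂ := by
    rw [cellCount, add_comm, ← Finset.sum_insert (f := fun ρ => weight ρ (b ρ) y₂) hτS]
    refine Finset.sum_le_sum_of_subset_of_nonneg ?_ fun ρ _ _ => weight_nonneg ρ (b ρ) y₂
    exact Finset.insert_subset hτ fun ρ hρ => hST ρ hρ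
  omega

/-- On σ, the intersection is where the coordinates of σ \ τ all vanish. Minus the sum of these
coordinates is the exposing functional, up to a constant. -/
theorem isExposed_inter (h : IsPseudoManifold A T b) {σ τ : Finset ι} (hσ : σ ∈ T)
    (hτ : τ ∈ T) : IsExposed ℝ (conv A σ) (conv A σ ∩ conv A τ) := by
  rintro ⟨w, hwσ, hwτ⟩
  have hbσ := h.bary σ hσ
  set g : (Fin d → ℝ) → ℝ := fun x => ∑ i ∈ σ \ τ, b σ i x with hg
  have hg0 : ∀ x ∈ conv A σ, x ∈ conv A τ → g x = 0 := by
    intro x hx hxτ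
    refine Finset.sum_eq_zero fun i hi => ?_
    rw [Finset.mem_sdiff] at hi
    refine le_antisymm (not_lt.1 fun h' => hi.2 (h.mem_of_pos hσ hτ hx hxτ hi.1 h')) ?_
    exact hbσ.mem_conv_iff.1 hx i hi.1
  have hgnn : ∀ x ∈ conv A σ, 0 ≤ g x := fun x hx => Finset.sum_nonneg fun i hi =>
    hbσ.mem_conv_iff.1 hx i (Finset.mem_sdiff.1 hi).1
  set l : (Fin d → ℝ) →ₗ[ℝ] ℝ := -∑ i ∈ σ \ τ, (b σ i).linear with hl
  have hlg : ∀ x, l x = g 0 - g x := by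
    intro x
    have : ∀ i, b σ i x = (b σ i).linear x + b σ i 0 := fun i => by
      simpa using congrFun (b σ i).decomp x
    simp only [hl, hg, LinearMap.neg_apply, LinearMap.sum_apply, this, Finset.sum_add_distrib]
    simp
  refine ⟨LinearMap.toContinuousLinearMap l, ?_⟩
  ext x
  simp only [LinearMap.coe_toContinuousLinearMap', hlg, Set.mem_inter_iff]
  constructor
  · rintro ⟨hx, hxτ⟩
    refine ⟨hx, fun y hy => ?_⟩
    have := hg0 x hx hxτ
    have := hgnn y hy
    linarith
  · rintro ⟨hx, hmax⟩
    have h0 : g x = 0 := by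
      have := hmax w hwσ
      have := hg0 w hwσ hwτ
      have := hgnn x hx
      linarith
    have hz := (Finset.sum_eq_zero_iff_of_nonneg fun i hi =>
      hbσ.mem_conv_iff.1 hx i (Finset.mem_sdiff.1 hi).1).1 h0
    refine ⟨hx, ?_⟩
    have hsub : ∀ {M : Type} [AddCommMonoid M] (f : ι → M), (∀ i ∈ σ \ τ, f i = 0) →
        ∑ i ∈ σ ∩ τ, f i = ∑ i ∈ σ, f i := by
      intro M _ f hf
      refine Finset.sum_subset Finset.inter_subset_left fun i hi hiτ => hf i ?_
      rw [Finset.mem_sdiff]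
      exact ⟨hi, fun h' => hiτ (Finset.mem_inter.2 ⟨hi, h'⟩)⟩
    rw [← hbσ.combo x, ← hsub _ fun i hi => by rw [hz i hi, zero_smul]]
    refine (convex_convexHull ℝ _).sum_mem (fun i hi => ?_) ?_ fun i hi => ?_
    · exact hbσ.mem_conv_iff.1 hx i (Finset.mem_inter.1 hi).1
    · rw [hsub _ hz, hbσ.sum_eq]
    · exact subset_convexHull ℝ _ ⟨i, (Finset.mem_inter.1 hi).2, rfl⟩

end IsPseudoManifold

end Criterion

/-! ### Simplices and circuits in general position -/

section GeneralPosition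

variable {ι : Type*} {d : ℕ}

/-- An affine dependence is a kernel vector of the homogenized matrix. -/
theorem affineIndependent_of_orientDet_ne_zero {A : ι → Fin d → ℝ} {s : Fin (d + 1) → ι}
    (h : orientDet A s ≠ 0) : AffineIndependent ℝ (fun i => A (s i)) := by
  rw [affineIndependent_iff_of_fintype]
  intro w hw0 hw i
  rw [Finset.weightedVSub_eq_linear_combination _ hw0] at hw
  refine congrFun (Matrix.eq_zero_of_mulVec_eq_zero h (v := w) ?_) i
  ext r
  refine Fin.cases ?_ (fun q => ?_) r
  · simpa [Matrix.mulVec, dotProduct] using hw0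
  · have := congrFun hw q
    simpa [Matrix.mulVec, dotProduct, mul_comm] using this

variable {A : ι → Fin d → ℝ}

theorem InGeneralPosition.affineIndependent_of_card_eq (hA : InGeneralPosition A) {σ : Finset ι}
    (hσ : #σ = d + 1) : AffineIndependent ℝ (fun i : σ => A i) := by
  set e := σ.equivFinOfCardEq hσ
  have := affineIndependent_of_orientDet_ne_zero
    (hA (fun k => e.symm k) fun a b hab => e.symm.injective (Subtype.ext hab))
  have h2 := this.comp_embedding e.toEmbedding
  convert h2 using 2 with i
  simp

/-- A linear functional that attains its maximum over a simplex at an interior point is constant on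
the vertices. -/
theorem IsBary.apply_mem_of_isExposed {σ : Finset ι} {b : ι → (Fin d → ℝ) →ᵃ[ℝ] ℝ}
    (h : IsBary A σ b) {I : Set (Fin d → ℝ)} (hI : IsExposed ℝ (conv A σ) I) {y : Fin d → ℝ}
    (hyI : y ∈ I) (hy : ∀ i ∈ σ, 0 < b i y) {k : ι} (hk : k ∈ σ) : A k ∈ I := by
  obtain ⟨l, hl⟩ := hI ⟨y, hyI⟩
  have hvert : ∀ i ∈ σ, A i ∈ conv A σ := fun i hi => subset_convexHull ℝ _ ⟨i, hi, rfl⟩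
  rw [hl] at hyI ⊢
  refine ⟨hvert k hk, ?_⟩
  have h0 : ∑ i ∈ σ, b i y * (l y - l (A i)) = 0 := by
    have h1 : l y = ∑ i ∈ σ, b i y * l (A i) := by
      conv_lhs => rw [← h.combo y]
      simp
    simp only [mul_sub, Finset.sum_sub_distrib, ← Finset.sum_mul, h.sum_eq, one_mul, ← h1, sub_self]
  have h2 := (Finset.sum_eq_zero_iff_of_nonneg fun i hi =>
    mul_nonneg (hy i hi).le (sub_nonneg.2 (hyI.2 _ (hvert i hi)))).1 h0 k hk
  have h3 : l y = l (A k) := by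
    rcases mul_eq_zero.1 h2 with h' | h'
    · exact absurd h' (hy k hk).ne'
    · linarith
  rw [← h3]
  exact hyI.2

variable [DecidableEq ι]

/-- Cramer's rule: writing A j in barycentric coordinates and expanding in the first column leaves
only the multiple of the column of i. -/
theorem IsBary.orientDet_cons {σ : Finset ι}
    {b : ι → (Fin d → ℝ) →ᵃ[ℝ] ℝ} (h : IsBary A σ b) {i : ι} (hi : i ∈ σ) {ρ : Fin d → ι}
    (hρ : Function.Injective ρ) (himg : univ.image ρ = σ.erase i) (j : ι) :
    orientDet A (Fin.cons j ρ : Fin (d + 1) → ι) =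
      b i (A j) * orientDet A (Fin.cons i ρ : Fin (d + 1) → ι) := by
  set M : Matrix (Fin (d + 1)) (Fin (d + 1)) ℝ := Matrix.of fun r c =>
    (Fin.cons (1 : ℝ) (A ((Fin.cons i ρ : Fin (d + 1) → ι) c)) : Fin (d + 1) → ℝ) r with hM
  set c : Fin (d + 1) → ℝ := Fin.cons (b i (A j)) fun m => b (ρ m) (A j) with hc
  have key := Matrix.det_updateCol_sum M 0 c
  have hsum : ∀ f : ι → ℝ, ∑ k ∈ σ, f k = f i + ∑ m, f (ρ m) := by
    intro f
    rw [← Finset.add_sum_erase σ f hi, ← himg, Finset.sum_image fun x _ y _ hxy => hρ hxy]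
  have hMj : (Matrix.of fun r c =>
      (Fin.cons (1 : ℝ) (A ((Fin.cons j ρ : Fin (d + 1) → ι) c)) : Fin (d + 1) → ℝ) r) =
      M.updateCol 0 fun r => ∑ k, c k • M r k := by
    ext r q
    refine Fin.cases ?_ (fun q => ?_) q
    · rw [Matrix.updateCol_self, Fin.sum_univ_succ]
      refine Fin.cases ?_ (fun r => ?_) r
      · have := h.sum_eq (A j)
        rw [hsum] at this
        simp [hM, hc, this]
      · have := congrFun (h.combo (A j)) r
        rw [Finset.sum_apply, hsum fun k => (b k (A j) • A k) r] at this
        simpa [hM, hc] using this.symm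
    · rw [Matrix.updateCol_ne (Fin.succ_ne_zero q)]
      simp [hM]
  rw [orientDet, hMj, key]
  rfl

theorem exists_isBary {σ : Finset ι}
    (hind : AffineIndependent ℝ (fun i : σ => A i)) (hcard : #σ = d + 1) :
    ∃ b, IsBary A σ b := by
  have htop : affineSpan ℝ (Set.range fun i : σ => A i) = ⊤ := by
    rw [hind.affineSpan_eq_top_iff_card_eq_finrank_add_one]
    simp [hcard]
  let B : AffineBasis σ ℝ (Fin d → ℝ) := ⟨fun i : σ => A i, hind, htop⟩
  have hB : ∀ i : σ, B i = A i := fun _ => rfl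
  refine ⟨fun k => if hk : k ∈ σ then B.coord ⟨k, hk⟩ else AffineMap.const ℝ _ 0, ?_, ?_, ?_, ?_⟩
  · intro x
    rw [← Finset.sum_coe_sort, ← B.sum_coord_apply_eq_one x]
    exact Finset.sum_congr rfl fun i _ => by simp
  · intro x
    rw [← Finset.sum_coe_sort σ fun i => (if hk : i ∈ σ then B.coord ⟨i, hk⟩ else
      AffineMap.const ℝ _ 0) x • A i]
    conv_rhs => rw [← B.linear_combination_coord_eq_self x]
    exact Finset.sum_congr rfl fun i _ => by simp [hB]
  · intro i hi
    rw [dif_pos hi, ← hB ⟨i, hi⟩, B.coord_apply_eq]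
  · intro i hi j hj hij
    rw [dif_pos hi, ← hB ⟨j, hj⟩, B.coord_apply_ne]
    simpa using hij

variable [Fintype ι]

namespace InGeneralPosition

theorem affineIndependent (hA : InGeneralPosition A) (hι : d + 1 ≤ Fintype.card ι)
    {σ : Finset ι} (hσ : #σ ≤ d + 1) : AffineIndependent ℝ (fun i : σ => A i) := by
  obtain ⟨τ, hστ, _, hτ⟩ := Finset.exists_subsuperset_card_eq (Finset.subset_univ σ) hσ
    (by rwa [Finset.card_univ])
  exact (hA.affineIndependent_of_card_eq hτ).comp_embedding
    ⟨fun i : σ => (⟨i, hστ i.2⟩ : τ), fun a b hab => Subtype.ext (congrArg (fun k : τ => (k : ι)) hab)⟩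

theorem injective (hA : InGeneralPosition A) (hι : d + 1 ≤ Fintype.card ι) (hd : 0 < d) :
    Function.Injective A := by
  intro x y hxy
  have hcard : #({x, y} : Finset ι) ≤ d + 1 := Finset.card_le_two.trans (by omega)
  have := (hA.affineIndependent hι hcard).injective
    (a₁ := ⟨x, by simp⟩) (a₂ := ⟨y, by simp⟩) hxy
  simpa using this

theorem affineSpan_eq_top (hA : InGeneralPosition A) {σ : Finset ι} (hσ : #σ = d + 1) :
    affineSpan ℝ (A '' (σ : Set ι)) = ⊤ := by
  have h := (hA.affineIndependent_of_card_eq hσ).affineSpan_eq_top_iff_card_eq_finrank_add_one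
  have hr : Set.range (fun i : σ => A i) = A '' (σ : Set ι) := by
    ext; simp
  rw [← hr, h]
  simp [hσ]

theorem affineSpan_range_eq_top (hA : InGeneralPosition A) (hι : d + 1 ≤ Fintype.card ι) :
    affineSpan ℝ (Set.range A) = ⊤ := by
  obtain ⟨τ, _, hτ⟩ := Finset.exists_subset_card_eq (s := (univ : Finset ι))
    (n := d + 1) (by rwa [Finset.card_univ])
  rw [eq_top_iff, ← hA.affineSpan_eq_top hτ]
  exact affineSpan_mono ℝ (Set.image_subset_range _ _)

/-- At most d + 1 points are independent, and any d + 2 points of ℝᵈ are dependent, so minimality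
leaves exactly d + 2. -/
theorem card_circuit (hA : InGeneralPosition A) (hι : d + 1 ≤ Fintype.card ι)
    {P M : Finset ι} (h : IsOrientedCircuit A P M) : #(P ∪ M) = d + 2 := by
  have h1 : d + 1 < #(P ∪ M) := by
    by_contra hle
    exact h.1 (hA.affineIndependent hι (not_lt.1 hle))
  by_contra hne
  obtain ⟨D, hD, hDc⟩ := Finset.exists_subset_card_eq (s := P ∪ M) (n := d + 2) (by omega)
  have hss : D ⊂ P ∪ M := Finset.ssubset_iff_subset_ne.2 ⟨hD, by rintro rfl; exact hne hDc⟩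
  have := (h.2.1 D hss).card_le_finrank_succ
  have h2 := this.trans (Nat.succ_le_succ (Submodule.finrank_le _))
  simp at h2
  omega

theorem card_cell (hA : InGeneralPosition A) (hι : d + 1 ≤ Fintype.card ι)
    {T : Finset (Finset ι)} (hT : IsTriangulation A T) {σ : Finset ι} (hσ : σ ∈ T) :
    #σ = d + 1 := by
  have hr : Set.range (fun i : σ => A i) = A '' (σ : Set ι) := by
    ext; simp
  have := (hT.affineIndependent σ hσ).affineSpan_eq_top_iff_card_eq_finrank_add_one
  rw [hr, hT.spanning σ hσ, hA.affineSpan_range_eq_top hι] at this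
  simpa using this

end InGeneralPosition

/-- In a triangulation two cells that share a ridge lie on opposite sides of it. -/
theorem IsTriangulation.eq_of_shared_ridge {T : Finset (Finset ι)} (hT : IsTriangulation A T)
    {ρ : Finset ι} (hne : ρ.Nonempty) {o x : ι} (ho : o ∉ ρ) (hx : x ∉ insert o ρ)
    (hoT : insert o ρ ∈ T) (hxT : insert x ρ ∈ T) {c b : ι → (Fin d → ℝ) →ᵃ[ℝ] ℝ}
    (hc : IsBary A (insert o ρ) c) (hb : IsBary A (insert x ρ) b) (hpos : 0 < c o (A x)) :
    A x = A o := by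
  have hxρ : x ∉ ρ := fun h => hx (Finset.mem_insert_of_mem h)
  have hoI := Finset.mem_insert_self o ρ
  have hxI := Finset.mem_insert_self x ρ
  have her : (insert o ρ).erase o = ρ := Finset.erase_insert ho
  have hrel : ∀ y, c o y = b x y * c o (A x) ∧ ∀ k ∈ ρ, c k y = b k y + b x y * c k (A x) := by
    intro y
    have := hc.eq_of_insert (i := o) hx (c := b) (by rw [her]; exact hb) y
    rw [her] at this
    exact ⟨this.1 hoI, this.2⟩
  obtain ⟨z, hz, hz0⟩ := hc.exists_pos (Finset.subset_insert o ρ) hne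
  have hzo : c o z = 0 := hz0 o hoI ho
  have hzx : b x z = 0 := by
    have := (hrel z).1
    rw [hzo] at this
    exact (mul_eq_zero.1 this.symm).resolve_right hpos.ne'
  obtain ⟨m, hm, _⟩ := hc.exists_pos subset_rfl ⟨o, hoI⟩
  -- A point close to the interior of the ridge, pushed to the common side, is interior to both
  -- cells.
  obtain ⟨ε, h0, h1, hε⟩ := exists_lineMap_mem
    (V := {y | ∀ k ∈ ρ, 0 < c k y} ∩ {y | ∀ k ∈ ρ, 0 < b k y})
    ((isOpen_pos ρ c).inter (isOpen_pos ρ b)) (x := z)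
    ⟨hz, fun k hk => by
      have := (hrel z).2 k hk
      rw [hzx, zero_mul, add_zero] at this
      rw [← this]
      exact hz k hk⟩ m
  set y := AffineMap.lineMap z m ε with hy
  have hco : 0 < c o y := by
    rw [hy, affineMap_lineMap, hzo, mul_zero, zero_add]
    exact mul_pos h0 (hm o hoI)
  have hbx : 0 < b x y := by
    have := (hrel y).1
    rw [this] at hco
    exact pos_of_mul_pos_left hco hpos.le
  have hcy : ∀ i ∈ insert o ρ, 0 < c i y := by
    intro i hi
    rcases Finset.mem_insert.1 hi with rfl | hi
    · exact hco
    · exact hε.1 i hi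
  have hby : ∀ i ∈ insert x ρ, 0 < b i y := by
    intro i hi
    rcases Finset.mem_insert.1 hi with rfl | hi
    · exact hbx
    · exact hε.2 i hi
  have hyI : y ∈ conv A (insert o ρ) ∩ conv A (insert x ρ) :=
    ⟨hc.mem_conv_iff.2 fun i hi => (hcy i hi).le, hb.mem_conv_iff.2 fun i hi => (hby i hi).le⟩
  -- The intersection is a face that contains an interior point of each cell, hence contains all
  -- vertices of both.
  have hface := hT.inter_isFace _ hoT _ hxT
  have hAo := (hc.apply_mem_of_isExposed hface.1 hyI hcy hoI).2
  have hAx := (hb.apply_mem_of_isExposed hface.2 hyI hby hxI).1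
  have hAo' := hb.mem_conv_iff.1 hAo
  have hAx' := hc.mem_conv_iff.1 hAx
  have hle : b x (A o) ≤ 1 := by
    rw [← hb.sum_eq (A o)]
    exact Finset.single_le_sum hAo' hxI
  -- The two apex coordinates are reciprocal, and both are at most 1 because each apex lies in the
  -- other cell. So both are 1 and the other coordinates vanish.
  have hone : 1 = b x (A o) * c o (A x) := by
    have := (hrel (A o)).1
    rwa [hc.apply_same o hoI] at this
  have hge : 1 ≤ c o (A x) := by nlinarith
  have hsum := hc.sum_eq (A x)
  rw [Finset.sum_insert ho] at hsum
  have hrest : ∑ k ∈ ρ, c k (A x) = 0 := by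
    have : 0 ≤ ∑ k ∈ ρ, c k (A x) :=
      Finset.sum_nonneg fun k hk => hAx' k (Finset.mem_insert_of_mem hk)
    linarith
  have hz' := (Finset.sum_eq_zero_iff_of_nonneg fun k hk =>
    hAx' k (Finset.mem_insert_of_mem hk)).1 hrest
  rw [← hc.combo (A x), Finset.sum_insert ho, Finset.sum_eq_zero fun k hk => by
    rw [hz' k hk, zero_smul], add_zero, show c o (A x) = 1 by linarith, one_smul]

end GeneralPosition

/-! ### Flips and the invariance of locked collections -/

section Flips

variable {ι : Type*} [Fintype ι] [DecidableEq ι] {d : ℕ} {A : ι → Fin d → ℝ}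

theorem IsOrientedCircuit.symm {P M : Finset ι} (h : IsOrientedCircuit A P M) :
    IsOrientedCircuit A M P := by
  obtain ⟨h1, h2, w, hw0, hw, hP, hM⟩ := h
  rw [Finset.union_comm] at h1 h2
  refine ⟨h1, h2, fun i => -w i, by simp [hw0], by simp [hw], fun i => ?_, fun i => ?_⟩
  · simpa using hM i
  · simpa using hP i

theorem IsOrientedCircuit.nonempty {P M : Finset ι} (h : IsOrientedCircuit A P M)
    (hne : (P ∪ M).Nonempty) : P.Nonempty := by
  obtain ⟨_, _, w, hw0, _, hP, hM⟩ := h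
  by_contra hP0
  rw [Finset.not_nonempty_iff_eq_empty] at hP0
  have hle : ∀ i ∈ univ, w i ≤ 0 := fun i _ => by
    by_contra hlt
    have := (hP i).2 (not_le.1 hlt)
    simp [hP0] at this
  have h0 := (Finset.sum_eq_zero_iff_of_nonpos hle).1 hw0
  obtain ⟨i, hi⟩ := hne
  rw [hP0, Finset.empty_union, hM] at hi
  exact hi.ne (h0 i (Finset.mem_univ i))

theorem join_singleton_empty (S : Finset (Finset ι)) : join {∅} S = S := by
  ext τ
  simp [join]

theorem mem_circuitTriangulation {P M σ : Finset ι} :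
    σ ∈ circuitTriangulation P M ↔ ∃ c ∈ P, (P ∪ M).erase c = σ :=
  Finset.mem_image

/-- In general position a flip only exchanges the two triangulations of its circuit. -/
theorem IsFlip.exists_circuit (hA : InGeneralPosition A) (hι : d + 1 ≤ Fintype.card ι)
    {T₁ T₂ : Finset (Finset ι)} (hT₁ : IsTriangulation A T₁) (h : IsFlip A T₁ T₂) :
    ∃ P M, IsOrientedCircuit A P M ∧ circuitTriangulation P M ⊆ T₁ ∧
      T₂ = (T₁ \ circuitTriangulation P M) ∪ circuitTriangulation M P := by
  obtain ⟨P, M, L, hC, ⟨ρ, hρ⟩, hL, hT₂⟩ := h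
  have hcard := hA.card_circuit hι hC
  -- The simplices C \ {c} already have d + 1 elements, the size of a cell, so nothing can be joined
  -- to them.
  have hlink : ∀ τ ∈ circuitTriangulation P M, ∀ ρ ∈ L, ρ = ∅ ∧ τ ∈ T₁ := by
    intro τ hτ ρ hρ
    rw [← hL τ hτ, link, Finset.mem_filter] at hρ
    obtain ⟨_, hdisj, hmem⟩ := hρ
    obtain ⟨c, hc, rfl⟩ := mem_circuitTriangulation.1 hτ
    have h1 := hA.card_cell hι hT₁ hmem
    rw [Finset.card_union_of_disjoint hdisj,
      Finset.card_erase_of_mem (Finset.mem_union_left M hc), hcard] at h1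
    have h0 : ρ = ∅ := Finset.card_eq_zero.1 (by omega)
    subst h0
    exact ⟨rfl, by simpa using hmem⟩
  obtain ⟨c, hc⟩ := hC.nonempty (Finset.card_pos.1 (by omega))
  have hτ : (P ∪ M).erase c ∈ circuitTriangulation P M :=
    mem_circuitTriangulation.2 ⟨c, hc, rfl⟩
  have hL0 : L = {∅} := Finset.eq_singleton_iff_unique_mem.2
    ⟨(hlink _ hτ ρ hρ).1 ▸ hρ, fun ρ' hρ' => (hlink _ hτ ρ' hρ').1⟩
  refine ⟨P, M, hC, fun τ hτ => (hlink τ hτ ρ hρ).2, ?_⟩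
  rw [hT₂, hL0, join_singleton_empty, join_singleton_empty]

/-- A collection of cells such that a point that is not a vertex of a cell sees the cell through
a facet that is shared with another cell of the collection, and is on the side of that cell. -/
def IsLocked (A : ι → Fin d → ℝ) (K : Finset (Finset ι)) : Prop :=
  ∀ κ ∈ K, ∀ x, x ∉ κ → ∃ e ∈ κ, ∃ o, o ∉ κ ∧ o ≠ x ∧ insert o (κ.erase e) ∈ K ∧
    ∃ ρ : Fin d → ι, Function.Injective ρ ∧ univ.image ρ = κ.erase e ∧
      orientDet A (Fin.cons x ρ : Fin (d + 1) → ι) *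
        orientDet A (Fin.cons e ρ : Fin (d + 1) → ι) < 0 ∧
      0 < orientDet A (Fin.cons x ρ : Fin (d + 1) → ι) *
        orientDet A (Fin.cons o ρ : Fin (d + 1) → ι)

theorem IsLocked.notMem_circuitTriangulation (hA : InGeneralPosition A)
    (hι : d + 1 ≤ Fintype.card ι) (hd : 0 < d) {K T : Finset (Finset ι)} (hK : IsLocked A K)
    (hT : IsTriangulation A T) (hKT : K ⊆ T) {P M : Finset ι} (hC : IsOrientedCircuit A P M)
    (hPM : circuitTriangulation P M ⊆ T) {κ : Finset ι} (hκ : κ ∈ K) :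
    κ ∉ circuitTriangulation P M := by
  intro hmem
  obtain ⟨x, hxP, rfl⟩ := mem_circuitTriangulation.1 hmem
  obtain ⟨e, he, o, ho, hox, hoK, ρ, hρ, himg, hneg, hpos⟩ := hK _ hκ x (Finset.notMem_erase _ _)
  set κ := (P ∪ M).erase x with hκdef
  have hxκ : x ∉ κ := Finset.notMem_erase _ _
  obtain ⟨b, hb⟩ := exists_isBary (hT.affineIndependent _ (hKT hκ)) (hA.card_cell hι hT (hKT hκ))
  obtain ⟨c, hc⟩ := exists_isBary (hT.affineIndependent _ (hKT hoK))
    (hA.card_cell hι hT (hKT hoK))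
  have hbx : b e (A x) < 0 := by
    rw [hb.orientDet_cons he hρ himg x, mul_assoc] at hneg
    exact neg_of_mul_neg_left hneg (mul_self_nonneg _)
  have hoρ : o ∉ κ.erase e := fun h => ho (Finset.mem_of_mem_erase h)
  have hcx : 0 < c o (A x) := by
    rw [hc.orientDet_cons (Finset.mem_insert_self _ _) hρ
      (by rw [himg, Finset.erase_insert hoρ]) x, mul_assoc] at hpos
    exact pos_of_mul_pos_left hpos (mul_self_nonneg _)
  -- Applying the e-th coordinate of κ to the dependence leaves only the terms of e and x: the
  -- coefficient of e is minus that of x times a negative number.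
  have heP : e ∈ P := by
    obtain ⟨_, _, w, hw0, hw, hP, hM⟩ := hC
    have hzero : ∀ i, i ∉ P ∪ M → w i = 0 := by
      intro i hi
      rw [Finset.mem_union, hP, hM, not_or, not_lt, not_lt] at hi
      exact le_antisymm hi.1 hi.2
    have hdec : ∀ y, b e y = (b e).linear y + b e 0 := fun y => by
      simpa using congrFun (b e).decomp y
    have hsum : ∑ i, w i * b e (A i) = 0 := by
      have h1 : (b e).linear (∑ i, w i • A i) = 0 := by rw [hw, map_zero]
      rw [map_sum] at h1
      simp only [map_smul, smul_eq_mul] at h1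
      calc ∑ i, w i * b e (A i) = ∑ i, (w i * (b e).linear (A i) + w i * b e 0) :=
            Finset.sum_congr rfl fun i _ => by rw [hdec]; ring
        _ = 0 := by rw [Finset.sum_add_distrib, h1, ← Finset.sum_mul, hw0, zero_mul, zero_add]
    have hex : e ≠ x := by rintro rfl; exact hxκ he
    rw [← Finset.sum_subset (Finset.subset_univ {e, x}), Finset.sum_pair hex,
      hb.apply_same e he, mul_one] at hsum
    · rw [hP]
      have := mul_neg_of_pos_of_neg ((hP x).1 hxP) hbx
      linarith
    · intro i _ hi
      simp only [Finset.mem_insert, Finset.mem_singleton, not_or] at hi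
      by_cases hiC : i ∈ P ∪ M
      · rw [hb.apply_ne e he i (Finset.mem_erase.2 ⟨hi.2, hiC⟩) (Ne.symm hi.1), mul_zero]
      · rw [hzero i hiC, zero_mul]
  have heq : (P ∪ M).erase e = insert x (κ.erase e) := by
    have hex : e ≠ x := by rintro rfl; exact hxκ he
    rw [hκdef, Finset.erase_right_comm, Finset.insert_erase]
    exact Finset.mem_erase.2 ⟨hex.symm, Finset.mem_union_left _ hxP⟩
  have hxT : insert x (κ.erase e) ∈ T := heq ▸ hPM (mem_circuitTriangulation.2 ⟨e, heP, rfl⟩)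
  obtain ⟨b', hb'⟩ := exists_isBary (hT.affineIndependent _ hxT) (hA.card_cell hι hT hxT)
  have hne : (κ.erase e).Nonempty := by
    rw [← Finset.card_pos, Finset.card_erase_of_mem he, hA.card_cell hι hT (hKT hκ)]
    omega
  have hx : x ∉ insert o (κ.erase e) := by
    simp only [Finset.mem_insert, not_or]
    exact ⟨hox.symm, fun h => hxκ (Finset.mem_of_mem_erase h)⟩
  exact hox (hA.injective hι hd
    (hT.eq_of_shared_ridge hne hoρ hx (hKT hoK) hxT hc hb' hcx)).symm

/-- The cells removed from T₁ and those added to T₂ are the two triangulations of one circuit. The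
exclusion lemma applies to either of them, with the circuit reversed in the second case. -/
theorem IsLocked.subset_iff_of_isFlip (hA : InGeneralPosition A)
    (hι : d + 1 ≤ Fintype.card ι) (hd : 0 < d) {K T₁ T₂ : Finset (Finset ι)} (hK : IsLocked A K)
    (hT₁ : IsTriangulation A T₁) (hT₂ : IsTriangulation A T₂) (h : IsFlip A T₁ T₂) :
    K ⊆ T₁ ↔ K ⊆ T₂ := by
  obtain ⟨P, M, hC, hP, rfl⟩ := h.exists_circuit hA hι hT₁
  constructor
  · intro hKT κ hκ
    have := hK.notMem_circuitTriangulation hA hι hd hT₁ hKT hC hP hκ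
    exact Finset.mem_union_left _ (Finset.mem_sdiff.2 ⟨hKT hκ, this⟩)
  · intro hKT κ hκ
    have := hK.notMem_circuitTriangulation hA hι hd hT₂ hKT hC.symm Finset.subset_union_right hκ
    exact (Finset.mem_sdiff.1 ((Finset.mem_union.1 (hKT hκ)).resolve_right this)).1

theorem IsLocked.not_preconnected (hA : InGeneralPosition A)
    (hι : d + 1 ≤ Fintype.card ι) (hd : 0 < d) {K T₁ T₂ : Finset (Finset ι)} (hK : IsLocked A K)
    (hT₁ : IsTriangulation A T₁) (hT₂ : IsTriangulation A T₂) (hK₁ : K ⊆ T₁) (hK₂ : ¬ K ⊆ T₂) :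
    ¬ (flipGraph A).Preconnected := by
  intro hconn
  have hr := (SimpleGraph.reachable_iff_reflTransGen _ _).1 (hconn ⟨T₁, hT₁⟩ ⟨T₂, hT₂⟩)
  have hinv : ∀ T : {T : Finset (Finset ι) // IsTriangulation A T},
      Relation.ReflTransGen (flipGraph A).Adj ⟨T₁, hT₁⟩ T → K ⊆ T.1 := by
    intro T hT
    induction hT with
    | refl => exact hK₁
    | tail _ hadj ih =>
      rw [flipGraph, SimpleGraph.fromRel_adj] at hadj
      rcases hadj.2 with hf | hf
      · exact (hK.subset_iff_of_isFlip hA hι hd (Subtype.prop _) (Subtype.prop _) hf).1 ih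
      · exact (hK.subset_iff_of_isFlip hA hι hd (Subtype.prop _) (Subtype.prop _) hf).2 ih
  exact hK₂ (hinv _ hr)

end Flips

/-! ### Certified positivity of polynomials over ℤ[√2] -/

section Evaluator

/-- The element `(a - b) + (c - d) √2` of `ℤ[√2]`. -/
structure SqrtInt where
  /-- The positive part of the rational part. -/
  a : ℕ
  /-- The negative part of the rational part. -/
  b : ℕ
  /-- The positive part of the coefficient of `√2`. -/
  c : ℕ
  /-- The negative part of the coefficient of `√2`. -/
  d : ℕ

namespace SqrtInt

/-- The value in `ℝ`. -/
noncomputable def eval (x : SqrtInt) : ℝ := (x.a - x.b) + (x.c - x.d) * √2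

/-- Addition. -/
def add (x y : SqrtInt) : SqrtInt := ⟨x.a.add y.a, x.b.add y.b, x.c.add y.c, x.d.add y.d⟩

/-- Negation. -/
def neg (x : SqrtInt) : SqrtInt := ⟨x.b, x.a, x.d, x.c⟩

/-- Products of two √2-parts enter the rational part with the factor 2. Keeping positive and
negative parts separate means that evaluation only needs natural numbers. -/
def mul (x y : SqrtInt) : SqrtInt :=
  ⟨((x.a.mul y.a).add (x.b.mul y.b)).add (Nat.mul 2 ((x.c.mul y.c).add (x.d.mul y.d))),
    ((x.a.mul y.b).add (x.b.mul y.a)).add (Nat.mul 2 ((x.c.mul y.d).add (x.d.mul y.c))),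
    (((x.a.mul y.c).add (x.b.mul y.d)).add (x.c.mul y.a)).add (x.d.mul y.b),
    (((x.a.mul y.d).add (x.b.mul y.c)).add (x.c.mul y.b)).add (x.d.mul y.a)⟩

theorem eval_add (x y : SqrtInt) : (add x y).eval = x.eval + y.eval := by
  simp only [add, eval, Nat.add_eq]; push_cast; ring

theorem eval_neg (x : SqrtInt) : (neg x).eval = -x.eval := by
  simp only [neg, eval]; ring

theorem eval_mul (x y : SqrtInt) : (mul x y).eval = x.eval * y.eval := by
  have h2 : √2 * √2 = 2 := Real.mul_self_sqrt (by norm_num)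
  simp only [mul, eval, Nat.add_eq, Nat.mul_eq]
  push_cast
  linear_combination (-((x.c : ℝ) - x.d) * (y.c - y.d)) * h2

/-- A thousand times an upper bound for the negative terms. -/
def lower (x : SqrtInt) : ℕ := 1000 * x.b + 1415 * (x.d - x.c)

/-- A thousand times a lower bound for the positive terms. -/
def upper (x : SqrtInt) : ℕ := 1000 * x.a + 1414 * (x.c - x.d)

/-- Uses 1.414 ≤ √2 ≤ 1.415. Truncated subtraction selects the bound that suits the sign of the
coefficient of √2. -/
theorem upper_sub_lower_le (x : SqrtInt) : (x.upper : ℝ) - x.lower ≤ 1000 * x.eval := by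
  have hs1 : 1414 / 1000 ≤ √2 := Real.le_sqrt_of_sq_le (by norm_num)
  have hs2 : √2 ≤ 1415 / 1000 := Real.sqrt_le_iff.2 (by norm_num)
  simp only [upper, lower, eval]
  rcases le_total x.c x.d with h | h
  · have h' : (x.c : ℝ) ≤ x.d := by exact_mod_cast h
    rw [Nat.sub_eq_zero_of_le h]
    push_cast [Nat.cast_sub h]
    nlinarith
  · have h' : (x.d : ℝ) ≤ x.c := by exact_mod_cast h
    rw [Nat.sub_eq_zero_of_le h]
    push_cast [Nat.cast_sub h]
    nlinarith

end SqrtInt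

/-- Polynomials in `t` over `ℤ[√2]`. -/
abbrev SqrtPoly := List SqrtInt

namespace SqrtPoly

/-- The value of a polynomial at `t`. -/
noncomputable def eval (t : ℝ) : SqrtPoly → ℝ
  | [] => 0
  | x :: p => x.eval + t * eval t p

theorem eval_cons (t : ℝ) (x : SqrtInt) (p : SqrtPoly) :
    eval t (x :: p) = x.eval + t * eval t p := rfl

/-- Addition of polynomials. -/
def add : SqrtPoly → SqrtPoly → SqrtPoly
  | [], q => q
  | p, [] => p
  | x :: p, y :: q => x.add y :: add p q

/-- Negation of polynomials. -/
def neg (p : SqrtPoly) : SqrtPoly := p.map SqrtInt.neg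

/-- Subtraction of polynomials. -/
def sub (p q : SqrtPoly) : SqrtPoly := add p (neg q)

/-- Multiplication of polynomials. -/
def mul : SqrtPoly → SqrtPoly → SqrtPoly
  | [], _ => []
  | [x], q => q.map x.mul
  | x :: p, q => add (q.map x.mul) (⟨0, 0, 0, 0⟩ :: mul p q)

theorem eval_add (t : ℝ) (p q : SqrtPoly) : eval t (add p q) = eval t p + eval t q := by
  induction p generalizing q with
  | nil => simp [add, eval]
  | cons x p ih =>
    cases q with
    | nil => simp [add, eval]
    | cons y q => simp only [add, eval, ih, SqrtInt.eval_add]; ring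

theorem eval_neg (t : ℝ) (p : SqrtPoly) : eval t (neg p) = -eval t p := by
  induction p with
  | nil => simp [neg, eval]
  | cons x p ih =>
    rw [neg] at ih
    simp only [neg, List.map_cons, eval, ih, SqrtInt.eval_neg]; ring

theorem eval_sub (t : ℝ) (p q : SqrtPoly) : eval t (sub p q) = eval t p - eval t q := by
  rw [sub, eval_add, eval_neg, sub_eq_add_neg]

theorem eval_map_mul (t : ℝ) (x : SqrtInt) (p : SqrtPoly) :
    eval t (p.map x.mul) = x.eval * eval t p := by
  induction p with
  | nil => simp [eval]
  | cons y p ih => simp only [List.map_cons, eval, ih, SqrtInt.eval_mul]; ring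

theorem eval_mul (t : ℝ) (p q : SqrtPoly) : eval t (mul p q) = eval t p * eval t q := by
  induction p with
  | nil => simp [mul, eval]
  | cons x p ih =>
    cases p with
    | nil => simp [mul, eval, eval_map_mul]
    | cons y p =>
      have h0 : (⟨0, 0, 0, 0⟩ : SqrtInt).eval = 0 := by simp [SqrtInt.eval]
      rw [mul, eval_add, eval_cons, ih, eval_map_mul, eval_cons t x, h0]
      · ring
      · simp

/-- A thousand times an upper bound for the negative of the value on `(0, 3/10)`. -/
def deficit : SqrtPoly → ℕ
  | [] => 0
  | x :: p => x.lower + (3 * deficit p + 9) / 10 - x.upper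

/-- A sufficient condition for a polynomial to be positive on `(0, 3/10)`. -/
def isPos : SqrtPoly → Bool
  | [] => false
  | x :: p => bif x.a == x.b && x.c == x.d then isPos p else
      Nat.blt (x.lower + (3 * deficit p + 9) / 10) x.upper

/-- One step of Horner's scheme: as t < 3/10, the tail contributes at least -3/10 of its deficit. -/
theorem lower_bound {t : ℝ} (h0 : 0 < t) (h1 : t < 3 / 10) (x : SqrtInt) (p : SqrtPoly)
    (hp : -(deficit p : ℝ) ≤ 1000 * eval t p) :
    (x.upper : ℝ) - (x.lower + (3 * deficit p + 9) / 10 : ℕ) ≤ 1000 * eval t (x :: p) := by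
  -- Adding 9 before dividing by 10 rounds up.
  have h2 : 3 * deficit p ≤ (3 * deficit p + 9) / 10 * 10 := by omega
  have h3 : (3 * deficit p : ℝ) ≤ ((3 * deficit p + 9) / 10 : ℕ) * 10 := by exact_mod_cast h2
  have h4 : (0 : ℝ) ≤ deficit p := Nat.cast_nonneg _
  have h5 := mul_le_mul_of_nonneg_left hp h0.le
  have h6 := x.upper_sub_lower_le
  rw [eval, Nat.cast_add]
  nlinarith

theorem neg_deficit_le {t : ℝ} (h0 : 0 < t) (h1 : t < 3 / 10) (p : SqrtPoly) :
    -(deficit p : ℝ) ≤ 1000 * eval t p := by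
  induction p with
  | nil => simp [deficit, eval]
  | cons x p ih =>
    refine le_trans ?_ (lower_bound h0 h1 x p ih)
    have h2 : x.lower + (3 * deficit p + 9) / 10 ≤ deficit (x :: p) + x.upper := by
      rw [deficit]; omega
    have h3 : ((x.lower + (3 * deficit p + 9) / 10 : ℕ) : ℝ) ≤ deficit (x :: p) + x.upper := by
      exact_mod_cast h2
    linarith

/-- A vanishing constant term amounts to a positive factor t, which is dropped. -/
theorem eval_pos {t : ℝ} (h0 : 0 < t) (h1 : t < 3 / 10) {p : SqrtPoly} (hp : isPos p = true) :
    0 < eval t p := by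
  induction p with
  | nil => simp [isPos] at hp
  | cons x p ih =>
    rw [isPos] at hp
    cases hx : (x.a == x.b && x.c == x.d)
    · rw [hx, cond_false, Nat.blt_eq] at hp
      have h2 : ((x.lower + (3 * deficit p + 9) / 10 : ℕ) : ℝ) < x.upper := by exact_mod_cast hp
      have := lower_bound h0 h1 x p (neg_deficit_le h0 h1 p)
      linarith
    · rw [hx, cond_true] at hp
      rw [Bool.and_eq_true, beq_iff_eq, beq_iff_eq] at hx
      rw [eval, SqrtInt.eval, hx.1, hx.2]
      simpa using mul_pos h0 (ih hp)

end SqrtPoly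

/-- The determinant of the rows `r`, ..., `r + n - 1` of the columns given by a list. -/
noncomputable def listDet {κ : Type*} [Inhabited κ] (E : ℕ → κ → ℝ) (r n : ℕ) (l : List κ) : ℝ :=
  Matrix.det (Matrix.of fun i j : Fin n => E (r + i) (l.getD j default))

theorem listDet_succ {κ : Type*} [Inhabited κ] (E : ℕ → κ → ℝ) (r n : ℕ) (l : List κ) :
    listDet E r (n + 1) l = ∑ j ∈ Finset.range (n + 1),
      (-1) ^ j * E r (l.getD j default) * listDet E (r + 1) n (l.eraseIdx j) := by
  rw [listDet, Matrix.det_succ_row_zero, Finset.sum_range]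
  refine Finset.sum_congr rfl fun j _ => ?_
  congr 2
  ext i k
  have hk : (j.succAbove k : ℕ) = if (k : ℕ) < j then (k : ℕ) else k + 1 := by
    rw [Fin.succAbove]
    simp only [Fin.lt_def, Fin.val_castSucc]
    split_ifs <;> simp
  simp only [Matrix.submatrix_apply, Matrix.of_apply, Fin.val_succ, List.getD_eq_getElem?_getD,
    List.getElem?_eraseIdx, hk, add_comm (i : ℕ) 1, add_assoc]
  split_ifs <;> rfl

end Evaluator

/-! ### Laplace expansion along pairs of rows -/

section Expansion

variable {κ : Type*} [Inhabited κ]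

/-- The minor of two columns in the rows `r` and `r + 1`. -/
def rowMinor (E : ℕ → κ → ℝ) (r : ℕ) (x y : κ) : ℝ := E r x * E (r + 1) y - E r y * E (r + 1) x

theorem listDet_five (E : ℕ → κ → ℝ) (r : ℕ) (a b c d e : κ) :
    listDet E r 5 [a, b, c, d, e] =
      rowMinor E r a b * listDet E (r + 2) 3 [c, d, e] - rowMinor E r a c * listDet E (r + 2) 3 [b, d, e]
      + rowMinor E r a d * listDet E (r + 2) 3 [b, c, e] - rowMinor E r a e * listDet E (r + 2) 3 [b, c, d]
      + rowMinor E r b c * listDet E (r + 2) 3 [a, d, e] - rowMinor E r b d * listDet E (r + 2) 3 [a, c, e]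
      + rowMinor E r b e * listDet E (r + 2) 3 [a, c, d] + rowMinor E r c d * listDet E (r + 2) 3 [a, b, e]
      - rowMinor E r c e * listDet E (r + 2) 3 [a, b, d] + rowMinor E r d e * listDet E (r + 2) 3 [a, b, c] := by
  rw [listDet_succ]
  simp only [listDet_succ E (r + 1), Finset.sum_range_succ, Finset.sum_range_zero,
    List.getD_cons_zero, List.getD_cons_succ, List.eraseIdx_cons_zero, List.eraseIdx_cons_succ,
    rowMinor, show r + 2 = r + 1 + 1 from rfl]
  ring

theorem listDet_seven (E : ℕ → κ → ℝ) (r : ℕ) (a b c d e f g : κ) :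
    listDet E r 7 [a, b, c, d, e, f, g] =
      rowMinor E r a b * listDet E (r + 2) 5 [c, d, e, f, g] - rowMinor E r a c * listDet E (r + 2) 5 [b, d, e, f, g]
      + rowMinor E r a d * listDet E (r + 2) 5 [b, c, e, f, g] - rowMinor E r a e * listDet E (r + 2) 5 [b, c, d, f, g]
      + rowMinor E r a f * listDet E (r + 2) 5 [b, c, d, e, g] - rowMinor E r a g * listDet E (r + 2) 5 [b, c, d, e, f]
      + rowMinor E r b c * listDet E (r + 2) 5 [a, d, e, f, g] - rowMinor E r b d * listDet E (r + 2) 5 [a, c, e, f, g]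
      + rowMinor E r b e * listDet E (r + 2) 5 [a, c, d, f, g] - rowMinor E r b f * listDet E (r + 2) 5 [a, c, d, e, g]
      + rowMinor E r b g * listDet E (r + 2) 5 [a, c, d, e, f] + rowMinor E r c d * listDet E (r + 2) 5 [a, b, e, f, g]
      - rowMinor E r c e * listDet E (r + 2) 5 [a, b, d, f, g] + rowMinor E r c f * listDet E (r + 2) 5 [a, b, d, e, g]
      - rowMinor E r c g * listDet E (r + 2) 5 [a, b, d, e, f] + rowMinor E r d e * listDet E (r + 2) 5 [a, b, c, f, g]
      - rowMinor E r d f * listDet E (r + 2) 5 [a, b, c, e, g] + rowMinor E r d g * listDet E (r + 2) 5 [a, b, c, e, f]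
      + rowMinor E r e f * listDet E (r + 2) 5 [a, b, c, d, g] - rowMinor E r e g * listDet E (r + 2) 5 [a, b, c, d, f]
      + rowMinor E r f g * listDet E (r + 2) 5 [a, b, c, d, e] := by
  rw [listDet_succ]
  simp only [listDet_succ E (r + 1), Finset.sum_range_succ, Finset.sum_range_zero,
    List.getD_cons_zero, List.getD_cons_succ, List.eraseIdx_cons_zero, List.eraseIdx_cons_succ,
    rowMinor, show r + 2 = r + 1 + 1 from rfl]
  ring

theorem listDet_three (E : ℕ → κ → ℝ) (r : ℕ) (x y z : κ) :
    listDet E r 3 [x, y, z] = E r x * rowMinor E (r + 1) y z - E r y * rowMinor E (r + 1) x z +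
      E r z * rowMinor E (r + 1) x y := by
  simp only [listDet, Matrix.det_fin_three, Matrix.of_apply, Fin.val_zero, Fin.val_one,
    Fin.val_two, List.getD_cons_zero, List.getD_cons_succ, rowMinor, add_zero, add_assoc,
    Nat.reduceAdd]
  ring

end Expansion

/-! ### The determinants of the 17 points and their signs -/

section Points

/-- The kind of a label: `2` for `O`, `0` for the points whose third and fourth coordinates vanish,
`1` for the points whose first and second coordinates vanish. -/
def kind (k : Fin 17) : ℕ :=
  ([2, 0, 0, 1, 1, 0, 0, 1, 1, 0, 0, 1, 1, 0, 0, 1, 1] : List ℕ).getD k 2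

/-- The two of the first four coordinates that need not vanish. -/
def planeCoord (k : Fin 17) : SqrtPoly × SqrtPoly :=
  let p₁ : SqrtPoly := [⟨1, 0, 0, 0⟩]
  let m₁ : SqrtPoly := [⟨0, 1, 0, 0⟩]
  let pt : SqrtPoly := [⟨0, 0, 0, 0⟩, ⟨1, 0, 0, 0⟩]
  let mt : SqrtPoly := [⟨0, 0, 0, 0⟩, ⟨0, 1, 0, 0⟩]
  ([([], []),
    (p₁, pt), (mt, p₁), (p₁, pt), (mt, p₁), (p₁, mt), (pt, p₁), (p₁, mt), (pt, p₁),
    (m₁, mt), (pt, m₁), (m₁, mt), (pt, m₁), (m₁, pt), (mt, m₁), (m₁, pt), (mt, m₁)] :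
    List (SqrtPoly × SqrtPoly)).getD k ([], [])

/-- The last two coordinates of the points of `config17 t`. -/
def tailCoord (k : Fin 17) : SqrtPoly × SqrtPoly :=
  let p₁ : SqrtPoly := [⟨1, 0, 0, 0⟩]
  let m₁ : SqrtPoly := [⟨0, 1, 0, 0⟩]
  let ps : SqrtPoly := [⟨0, 0, 1, 0⟩]
  let ms : SqrtPoly := [⟨0, 0, 0, 1⟩]
  ([([], []),
    (ps, []), (p₁, p₁), ([], ps), (m₁, p₁), (ms, []), (m₁, m₁), ([], ms), (p₁, m₁),
    (ps, []), (p₁, p₁), ([], ps), (m₁, p₁), (ms, []), (m₁, m₁), ([], ms), (p₁, m₁)] :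
    List (SqrtPoly × SqrtPoly)).getD k ([], [])

open SqrtPoly

/-- The determinant of two points in one of the coordinate planes. -/
def planeMinor (i j : Fin 17) : SqrtPoly :=
  sub (mul (planeCoord i).1 (planeCoord j).2) (mul (planeCoord j).1 (planeCoord i).2)

/-- The determinant of the last two coordinates of two points. -/
def tailMinor (i j : Fin 17) : SqrtPoly :=
  sub (mul (tailCoord i).1 (tailCoord j).2) (mul (tailCoord j).1 (tailCoord i).2)

/-- The combination of the values of `φ` at three points given by their plane coordinates. -/
def wedge₁ (φ : Fin 17 → SqrtPoly) (a b c : Fin 17) : SqrtPoly :=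
  add (sub (mul (planeMinor b c) (φ a)) (mul (planeMinor a c) (φ b))) (mul (planeMinor a b) (φ c))

/-- The combination of the values of `φ` at pairs of four points. -/
def wedge₂ (φ : Fin 17 → Fin 17 → SqrtPoly) (a b c d : Fin 17) : SqrtPoly :=
  add (sub (mul (planeMinor c d) (φ a b)) (mul (planeMinor b d) (φ a c)))
    (add (add (mul (planeMinor b c) (φ a d)) (mul (planeMinor a d) (φ b c)))
      (sub (mul (planeMinor a b) (φ c d)) (mul (planeMinor a c) (φ b d))))

/-- The combination of the values of `φ` at triples of five points. -/
def wedge₃ (φ : Fin 17 → Fin 17 → Fin 17 → SqrtPoly) (a b c d e : Fin 17) : SqrtPoly :=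
  add (wedge₂ (fun x y => φ x y e) a b c d)
    (add (sub (mul (planeMinor d e) (φ a b c)) (mul (planeMinor c e) (φ a b d)))
      (sub (mul (planeMinor b e) (φ a c d)) (mul (planeMinor a e) (φ b c d))))

/-- The determinant of three points in one and four points in the other coordinate plane. -/
def det₃₄ (a b c d e f g : Fin 17) : SqrtPoly :=
  add (sub (mul (wedge₁ (fun _ => [⟨1, 0, 0, 0⟩]) a b c) (wedge₂ tailMinor d e f g))
    (mul (wedge₁ (fun x => (tailCoord x).1) a b c)
      (wedge₂ (fun x y => sub (tailCoord y).2 (tailCoord x).2) d e f g)))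
    (mul (wedge₁ (fun x => (tailCoord x).2) a b c)
      (wedge₂ (fun x y => sub (tailCoord y).1 (tailCoord x).1) d e f g))

/-- The determinant of three points in each coordinate plane and `O`. -/
def det₃₃ (a b c d e f : Fin 17) : SqrtPoly :=
  sub (mul (wedge₁ (fun x => (tailCoord x).1) a b c) (wedge₁ (fun x => (tailCoord x).2) d e f))
    (mul (wedge₁ (fun x => (tailCoord x).2) a b c) (wedge₁ (fun x => (tailCoord x).1) d e f))

/-- The determinant of two points in one and five points in the other coordinate plane. -/
def det₂₅ (a b c d e f g : Fin 17) : SqrtPoly :=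
  mul (planeMinor a b) (wedge₃ (fun x y z =>
    add (sub (tailMinor y z) (tailMinor x z)) (tailMinor x y)) c d e f g)

/-- The determinant of seven points, ordered by their kinds; `0` for kinds not needed here. -/
def polyDet : List (Fin 17) → SqrtPoly
  | [a, b, c, d, e, f, g] =>
    match [kind a, kind b, kind c, kind d, kind e, kind f, kind g] with
    | [0, 0, 0, 1, 1, 1, 2] => det₃₃ a b c d e f
    | [0, 0, 0, 0, 1, 1, 1] => det₃₄ e f g a b c d
    | [0, 0, 0, 1, 1, 1, 1] => det₃₄ a b c d e f g
    | [0, 0, 0, 0, 1, 1, 2] => mul (planeMinor e f) (wedge₂ tailMinor a b c d)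
    | [0, 0, 1, 1, 1, 1, 2] => mul (planeMinor a b) (wedge₂ tailMinor c d e f)
    | [0, 0, 0, 0, 0, 1, 1] => det₂₅ f g a b c d e
    | [0, 0, 1, 1, 1, 1, 1] => det₂₅ a b c d e f g
    | _ => []
  | _ => []

/-- The rows of the homogenized points of `config17 t`, in the order `x₁, x₂, x₃, x₄, 1, x₅, x₆`. -/
noncomputable def homogRow (t : ℝ) (r : ℕ) (k : Fin 17) : ℝ :=
  ([config17 t k 0, config17 t k 1, config17 t k 2, config17 t k 3, 1, config17 t k 4,
    config17 t k 5] : List ℝ).getD r 0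

theorem homogRow_of_kind (t : ℝ) (k : Fin 17) :
    (kind k = 0 → homogRow t 0 k = (planeCoord k).1.eval t ∧
      homogRow t 1 k = (planeCoord k).2.eval t ∧ homogRow t 2 k = 0 ∧ homogRow t 3 k = 0) ∧
    (kind k = 1 → homogRow t 2 k = (planeCoord k).1.eval t ∧
      homogRow t 3 k = (planeCoord k).2.eval t ∧ homogRow t 0 k = 0 ∧ homogRow t 1 k = 0) ∧
    (kind k = 2 → homogRow t 0 k = 0 ∧ homogRow t 1 k = 0 ∧ homogRow t 2 k = 0 ∧
      homogRow t 3 k = 0 ∧ homogRow t 5 k = 0 ∧ homogRow t 6 k = 0) := by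
  fin_cases k <;> simp [homogRow, config17, kind, planeCoord, eval, SqrtInt.eval]

theorem homogRow_tail (t : ℝ) (k : Fin 17) : homogRow t 4 k = 1 ∧
    homogRow t 5 k = (tailCoord k).1.eval t ∧ homogRow t 6 k = (tailCoord k).2.eval t := by
  fin_cases k <;> simp [homogRow, config17, tailCoord, eval, SqrtInt.eval]

theorem rowMinor_zero (t : ℝ) {i j : Fin 17} (hi : kind i = 0) (hj : kind j = 0) :
    rowMinor (homogRow t) 0 i j = (planeMinor i j).eval t := by
  simp only [rowMinor, zero_add, planeMinor, eval_sub, eval_mul,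
    ((homogRow_of_kind t i).1 hi).1, ((homogRow_of_kind t i).1 hi).2.1,
    ((homogRow_of_kind t j).1 hj).1, ((homogRow_of_kind t j).1 hj).2.1]

theorem rowMinor_two (t : ℝ) {i j : Fin 17} (hi : kind i = 1) (hj : kind j = 1) :
    rowMinor (homogRow t) 2 i j = (planeMinor i j).eval t := by
  simp only [rowMinor, Nat.reduceAdd, planeMinor, eval_sub, eval_mul,
    ((homogRow_of_kind t i).2.1 hi).1, ((homogRow_of_kind t i).2.1 hi).2.1,
    ((homogRow_of_kind t j).2.1 hj).1, ((homogRow_of_kind t j).2.1 hj).2.1]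

/-- Only pairs of points of kind 0 contribute to the expansion along rows 0 and 1. Together with the
analogue for rows 2 and 3, this removes most terms of `listDet_seven`. -/
theorem rowMinor_zero_eq_zero (t : ℝ) {i j : Fin 17} (h : kind i ≠ 0 ∨ kind j ≠ 0) :
    rowMinor (homogRow t) 0 i j = 0 := by
  have key : ∀ k, kind k ≠ 0 → homogRow t 0 k = 0 ∧ homogRow t (0 + 1) k = 0 := by
    intro k hk
    have hkind : ∀ k, kind k ≠ 0 → kind k = 1 ∨ kind k = 2 := by decide
    obtain ⟨_, h1, h2⟩ := homogRow_of_kind t k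
    rcases hkind k hk with h | h
    · exact (h1 h).2.2
    · exact ⟨(h2 h).1, (h2 h).2.1⟩
  rcases h with h | h <;> simp [rowMinor, key _ h]

theorem rowMinor_two_eq_zero (t : ℝ) {i j : Fin 17} (h : kind i ≠ 1 ∨ kind j ≠ 1) :
    rowMinor (homogRow t) 2 i j = 0 := by
  have key : ∀ k, kind k ≠ 1 → homogRow t 2 k = 0 ∧ homogRow t (2 + 1) k = 0 := by
    intro k hk
    have hkind : ∀ k, kind k ≠ 1 → kind k = 0 ∨ kind k = 2 := by decide
    obtain ⟨h0, _, h2⟩ := homogRow_of_kind t k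
    rcases hkind k hk with h | h
    · exact (h0 h).2.2
    · exact ⟨(h2 h).2.2.1, (h2 h).2.2.2.1⟩
  rcases h with h | h <;> simp [rowMinor, key _ h]

theorem listDet_homogRow_three (t : ℝ) (x y z : Fin 17) :
    listDet (homogRow t) 4 3 [x, y, z] = (tailMinor y z).eval t - (tailMinor x z).eval t +
      (tailMinor x y).eval t := by
  simp only [listDet_three, homogRow_tail, rowMinor, tailMinor, eval_sub, eval_mul, Nat.reduceAdd]
  ring

theorem tailCoord_eval_of_kind (t : ℝ) {j : Fin 17} (h : kind j = 2) :
    (tailCoord j).1.eval t = 0 ∧ (tailCoord j).2.eval t = 0 := by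
  rw [← (homogRow_tail t j).2.1, ← (homogRow_tail t j).2.2]
  exact ((homogRow_of_kind t j).2.2 h).2.2.2.2

set_option linter.unusedSimpArgs false

/-- In this and the following expansions the first four rows are used up by two points of each kind,
and the remaining three points enter through a 3 × 3 minor of the rows 1, x₅, x₆. If O is among the
points, its last two coordinates vanish as well. -/
theorem det₃₃_eval (t : ℝ) {a b c d e f g : Fin 17}
    (h : [kind a, kind b, kind c, kind d, kind e, kind f, kind g] = [0, 0, 0, 1, 1, 1, 2]) :
    (det₃₃ a b c d e f).eval t = listDet (homogRow t) 0 7 [a, b, c, d, e, f, g] := by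
  simp only [List.cons.injEq, and_true] at h
  obtain ⟨ha, hb, hc, hd, he, hf, hg⟩ := h
  rw [listDet_seven]
  simp only [rowMinor_zero_eq_zero, rowMinor_zero, ha, hb, hc, hd, he, hf, hg, ne_eq, one_ne_zero,
    OfNat.ofNat_ne_zero, not_false_eq_true, true_or, or_true, zero_mul, add_zero, sub_zero]
  simp only [listDet_five, rowMinor_two_eq_zero, rowMinor_two, ha, hb, hc, hd, he, hf, hg, ne_eq,
    zero_ne_one, OfNat.ofNat_ne_one, not_false_eq_true, true_or, or_true, zero_mul, add_zero,
    sub_zero, zero_add, Nat.reduceAdd]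
  simp only [listDet_homogRow_three, det₃₃, det₃₄, det₂₅, wedge₁,
    wedge₂, wedge₃, eval_add, eval_sub, eval_mul, tailMinor,
    tailCoord_eval_of_kind t hg, mul_zero, zero_mul, sub_zero, add_zero, zero_add]
  ring

theorem det₄₃_eval (t : ℝ) {a b c d e f g : Fin 17}
    (h : [kind a, kind b, kind c, kind d, kind e, kind f, kind g] = [0, 0, 0, 0, 1, 1, 1]) :
    (det₃₄ e f g a b c d).eval t = listDet (homogRow t) 0 7 [a, b, c, d, e, f, g] := by
  simp only [List.cons.injEq, and_true] at h
  obtain ⟨ha, hb, hc, hd, he, hf, hg⟩ := h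
  rw [listDet_seven]
  simp only [rowMinor_zero_eq_zero, rowMinor_zero, ha, hb, hc, hd, he, hf, hg, ne_eq, one_ne_zero,
    OfNat.ofNat_ne_zero, not_false_eq_true, true_or, or_true, zero_mul, add_zero, sub_zero]
  simp only [listDet_five, rowMinor_two_eq_zero, rowMinor_two, ha, hb, hc, hd, he, hf, hg, ne_eq,
    zero_ne_one, OfNat.ofNat_ne_one, not_false_eq_true, true_or, or_true, zero_mul, add_zero,
    sub_zero, zero_add, Nat.reduceAdd]
  simp only [listDet_homogRow_three, det₃₃, det₃₄, det₂₅, wedge₁,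
    wedge₂, wedge₃, eval_add, eval_sub, eval_mul, tailMinor,
    eval_cons, SqrtInt.eval, show eval t [] = 0 from rfl]
  push_cast
  ring

theorem det₃₄_eval (t : ℝ) {a b c d e f g : Fin 17}
    (h : [kind a, kind b, kind c, kind d, kind e, kind f, kind g] = [0, 0, 0, 1, 1, 1, 1]) :
    (det₃₄ a b c d e f g).eval t = listDet (homogRow t) 0 7 [a, b, c, d, e, f, g] := by
  simp only [List.cons.injEq, and_true] at h
  obtain ⟨ha, hb, hc, hd, he, hf, hg⟩ := h
  rw [listDet_seven]
  simp only [rowMinor_zero_eq_zero, rowMinor_zero, ha, hb, hc, hd, he, hf, hg, ne_eq, one_ne_zero,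
    OfNat.ofNat_ne_zero, not_false_eq_true, true_or, or_true, zero_mul, add_zero, sub_zero]
  simp only [listDet_five, rowMinor_two_eq_zero, rowMinor_two, ha, hb, hc, hd, he, hf, hg, ne_eq,
    zero_ne_one, OfNat.ofNat_ne_one, not_false_eq_true, true_or, or_true, zero_mul, add_zero,
    sub_zero, zero_add, Nat.reduceAdd]
  simp only [listDet_homogRow_three, det₃₃, det₃₄, det₂₅, wedge₁,
    wedge₂, wedge₃, eval_add, eval_sub, eval_mul, tailMinor,
    eval_cons, SqrtInt.eval, show eval t [] = 0 from rfl]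
  push_cast
  ring

theorem det₄₂_eval (t : ℝ) {a b c d e f g : Fin 17}
    (h : [kind a, kind b, kind c, kind d, kind e, kind f, kind g] = [0, 0, 0, 0, 1, 1, 2]) :
    (mul (planeMinor e f) (wedge₂ tailMinor a b c d)).eval t = listDet (homogRow t) 0 7 [a, b, c, d, e, f, g] := by
  simp only [List.cons.injEq, and_true] at h
  obtain ⟨ha, hb, hc, hd, he, hf, hg⟩ := h
  rw [listDet_seven]
  simp only [rowMinor_zero_eq_zero, rowMinor_zero, ha, hb, hc, hd, he, hf, hg, ne_eq, one_ne_zero,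
    OfNat.ofNat_ne_zero, not_false_eq_true, true_or, or_true, zero_mul, add_zero, sub_zero]
  simp only [listDet_five, rowMinor_two_eq_zero, rowMinor_two, ha, hb, hc, hd, he, hf, hg, ne_eq,
    zero_ne_one, OfNat.ofNat_ne_one, not_false_eq_true, true_or, or_true, zero_mul, add_zero,
    sub_zero, zero_add, Nat.reduceAdd]
  simp only [listDet_homogRow_three, det₃₃, det₃₄, det₂₅, wedge₁,
    wedge₂, wedge₃, eval_add, eval_sub, eval_mul, tailMinor,
    tailCoord_eval_of_kind t hg, mul_zero, zero_mul, sub_zero, add_zero, zero_add]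
  ring

theorem det₂₄_eval (t : ℝ) {a b c d e f g : Fin 17}
    (h : [kind a, kind b, kind c, kind d, kind e, kind f, kind g] = [0, 0, 1, 1, 1, 1, 2]) :
    (mul (planeMinor a b) (wedge₂ tailMinor c d e f)).eval t = listDet (homogRow t) 0 7 [a, b, c, d, e, f, g] := by
  simp only [List.cons.injEq, and_true] at h
  obtain ⟨ha, hb, hc, hd, he, hf, hg⟩ := h
  rw [listDet_seven]
  simp only [rowMinor_zero_eq_zero, rowMinor_zero, ha, hb, hc, hd, he, hf, hg, ne_eq, one_ne_zero,
    OfNat.ofNat_ne_zero, not_false_eq_true, true_or, or_true, zero_mul, add_zero, sub_zero]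
  simp only [listDet_five, rowMinor_two_eq_zero, rowMinor_two, ha, hb, hc, hd, he, hf, hg, ne_eq,
    zero_ne_one, OfNat.ofNat_ne_one, not_false_eq_true, true_or, or_true, zero_mul, add_zero,
    sub_zero, zero_add, Nat.reduceAdd]
  simp only [listDet_homogRow_three, det₃₃, det₃₄, det₂₅, wedge₁,
    wedge₂, wedge₃, eval_add, eval_sub, eval_mul, tailMinor,
    tailCoord_eval_of_kind t hg, mul_zero, zero_mul, sub_zero, add_zero, zero_add]
  ring

theorem det₅₂_eval (t : ℝ) {a b c d e f g : Fin 17}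
    (h : [kind a, kind b, kind c, kind d, kind e, kind f, kind g] = [0, 0, 0, 0, 0, 1, 1]) :
    (det₂₅ f g a b c d e).eval t = listDet (homogRow t) 0 7 [a, b, c, d, e, f, g] := by
  simp only [List.cons.injEq, and_true] at h
  obtain ⟨ha, hb, hc, hd, he, hf, hg⟩ := h
  rw [listDet_seven]
  simp only [rowMinor_zero_eq_zero, rowMinor_zero, ha, hb, hc, hd, he, hf, hg, ne_eq, one_ne_zero,
    OfNat.ofNat_ne_zero, not_false_eq_true, true_or, or_true, zero_mul, add_zero, sub_zero]
  simp only [listDet_five, rowMinor_two_eq_zero, rowMinor_two, ha, hb, hc, hd, he, hf, hg, ne_eq,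
    zero_ne_one, OfNat.ofNat_ne_one, not_false_eq_true, true_or, or_true, zero_mul, add_zero,
    sub_zero, zero_add, Nat.reduceAdd]
  simp only [listDet_homogRow_three, det₃₃, det₃₄, det₂₅, wedge₁,
    wedge₂, wedge₃, eval_add, eval_sub, eval_mul, tailMinor]
  ring

theorem det₂₅_eval (t : ℝ) {a b c d e f g : Fin 17}
    (h : [kind a, kind b, kind c, kind d, kind e, kind f, kind g] = [0, 0, 1, 1, 1, 1, 1]) :
    (det₂₅ a b c d e f g).eval t = listDet (homogRow t) 0 7 [a, b, c, d, e, f, g] := by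
  simp only [List.cons.injEq, and_true] at h
  obtain ⟨ha, hb, hc, hd, he, hf, hg⟩ := h
  rw [listDet_seven]
  simp only [rowMinor_zero_eq_zero, rowMinor_zero, ha, hb, hc, hd, he, hf, hg, ne_eq, one_ne_zero,
    OfNat.ofNat_ne_zero, not_false_eq_true, true_or, or_true, zero_mul, add_zero, sub_zero]
  simp only [listDet_five, rowMinor_two_eq_zero, rowMinor_two, ha, hb, hc, hd, he, hf, hg, ne_eq,
    zero_ne_one, OfNat.ofNat_ne_one, not_false_eq_true, true_or, or_true, zero_mul, add_zero,
    sub_zero, zero_add, Nat.reduceAdd]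
  simp only [listDet_homogRow_three, det₃₃, det₃₄, det₂₅, wedge₁,
    wedge₂, wedge₃, eval_add, eval_sub, eval_mul, tailMinor]
  ring

theorem polyDet_eval (t : ℝ) (l : List (Fin 17)) (h : polyDet l ≠ []) :
    (polyDet l).eval t = listDet (homogRow t) 0 7 l := by
  revert h
  unfold polyDet
  split
  · split
    · exact fun _ => det₃₃_eval t ‹_›
    · exact fun _ => det₄₃_eval t ‹_›
    · exact fun _ => det₃₄_eval t ‹_›
    · exact fun _ => det₄₂_eval t ‹_›
    · exact fun _ => det₂₄_eval t ‹_›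
    · exact fun _ => det₅₂_eval t ‹_›
    · exact fun _ => det₂₅_eval t ‹_›
    · exact fun h => absurd rfl h
  · exact fun h => absurd rfl h

/-- The determinant of the points with labels given by a list. -/
noncomputable def detOf {d : ℕ} (A : Fin 17 → Fin d → ℝ) (l : List (Fin 17)) : ℝ :=
  orientDet A fun k => l.getD k 0

theorem detOf_config17 (t : ℝ) (l : List (Fin 17)) (h : polyDet l ≠ []) :
    detOf (config17 t) l = (polyDet l).eval t := by
  rw [polyDet_eval t l h, detOf, orientDet, listDet]
  -- Moving the row of ones from the top to position 4 is a cycle of length five, hence even.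
  have h := Matrix.det_permute (Fin.cycleRange (4 : Fin 7)) (Matrix.of fun r c : Fin 7 =>
    (Fin.cons (1 : ℝ) (config17 t (l.getD c 0)) : Fin 7 → ℝ) r)
  have h4 : ((-1 : ℤˣ) ^ ((4 : Fin 7) : ℕ)) = 1 := by decide
  rw [Fin.sign_cycleRange, h4, Units.val_one, Int.cast_one, one_mul] at h
  rw [← h]
  congr 1
  ext r c
  fin_cases r <;> rfl

/-- The certified sign, for `0 < t < 3/10`, of the determinant of seven points of `config17 t`. -/
def certSign (l : List (Fin 17)) : SignType :=
  bif (polyDet l).isPos then 1 else bif (polyDet l).neg.isPos then -1 else 0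

theorem sign_detOf_config17 {t : ℝ} (h0 : 0 < t) (h1 : t < 3 / 10) {l : List (Fin 17)}
    (h : certSign l ≠ 0) : SignType.sign (detOf (config17 t) l) = certSign l := by
  have hne : polyDet l ≠ [] := fun h' => h (by rw [certSign, h']; rfl)
  rw [detOf_config17 t l hne]
  revert h
  rw [certSign]
  cases hp : (polyDet l).isPos
  · cases hn : (polyDet l).neg.isPos
    · simp
    · have := SqrtPoly.eval_pos h0 h1 hn
      rw [SqrtPoly.eval_neg] at this
      simp [sign_neg (neg_pos.1 this)]
  · simp [sign_pos (SqrtPoly.eval_pos h0 h1 hp)]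

theorem continuous_config17 : Continuous config17 := by
  refine continuous_pi fun k => continuous_pi fun r => ?_
  fin_cases k <;> fin_cases r <;> simp [config17] <;> fun_prop

/-- There are finitely many determinants, each continuous in t, so the non-zero ones keep their
signs near 0. -/
theorem eventually_isPerturbation_config17 :
    ∀ᶠ t in 𝓝 (0 : ℝ), IsPerturbation (config17 0) (config17 t) := by
  refine eventually_all.2 fun s => ?_
  by_cases h : orientDet (config17 0) s = 0
  · exact Eventually.of_forall fun t ht => absurd h ht
  have hcont : Continuous fun t => orientDet (config17 t) s := by
    refine Continuous.matrix_det (continuous_matrix fun r c => ?_)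
    refine Fin.cases ?_ (fun q => ?_) r
    · exact continuous_const
    · exact (continuous_apply q).comp ((continuous_apply (s c)).comp continuous_config17)
  rcases lt_or_gt_of_ne h with h | h
  · filter_upwards [(hcont.tendsto 0).eventually (gt_mem_nhds h)] with t ht _
    rw [sign_neg ht, sign_neg h]
  · filter_upwards [(hcont.tendsto 0).eventually (lt_mem_nhds h)] with t ht _
    rw [sign_pos ht, sign_pos h]

/-- One suitable determinant is 8√2 at t = 0 and would be negative for t ≥ 3/10: its linear term
already exceeds 8√2 there, and the higher terms are negative. -/
theorem lt_of_isPerturbation_config17 {t : ℝ} (h0 : 0 < t)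
    (h : IsPerturbation (config17 0) (config17 t)) : t < 3 / 10 := by
  have hp : polyDet [1, 2, 10, 3, 7, 4, 15] = [⟨0, 0, 10, 2⟩, ⟨16, 32, 4, 20⟩,
    ⟨12, 12, 24, 24⟩, ⟨16, 32, 4, 20⟩, ⟨0, 0, 2, 10⟩] := rfl
  have hev : ∀ t, orientDet (config17 t) (fun k => [1, 2, 10, 3, 7, 4, 15].getD k 0) =
      8 * √2 - (16 + 16 * √2) * t - (16 + 16 * √2) * t ^ 3 - 8 * √2 * t ^ 4 := by
    intro t
    have := detOf_config17 t [1, 2, 10, 3, 7, 4, 15] (by rw [hp]; simp)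
    rw [hp, detOf] at this
    rw [this]
    simp only [SqrtPoly.eval, SqrtInt.eval]
    push_cast
    ring
  have hs2 : √2 ≤ 1415 / 1000 := Real.sqrt_le_iff.2 (by norm_num)
  have hs : 0 < √2 := by positivity
  have hpos : 0 < orientDet (config17 0) (fun k => [1, 2, 10, 3, 7, 4, 15].getD k 0) := by
    rw [hev]; simp
  have := h _ hpos.ne'
  rw [sign_pos hpos, sign_eq_one_iff, hev] at this
  have h3 : 0 < (16 + 16 * √2) * t ^ 3 := by positivity
  have h4 : 0 < 8 * √2 * t ^ 4 := by positivity
  by_contra hle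
  rw [not_lt] at hle
  have := mul_le_mul_of_nonneg_left hle (by positivity : 0 ≤ 16 + 16 * √2)
  linarith

/-- The signs of the determinants of `A'` are the certified ones. -/
def HasCertSigns (A : Fin 17 → Fin 6 → ℝ) : Prop :=
  ∀ l : List (Fin 17), certSign l ≠ 0 → SignType.sign (detOf A l) = certSign l

theorem IsPerturbation.hasCertSigns {t : ℝ} (h0 : 0 < t)
    (h : IsPerturbation (config17 0) (config17 t)) {A : Fin 17 → Fin 6 → ℝ}
    (hA : IsPerturbation (config17 t) A) : HasCertSigns A := by
  intro l hne
  have hs := sign_detOf_config17 h0 (lt_of_isPerturbation_config17 h0 h) hne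
  rw [← hs]
  refine hA _ fun h' => hne ?_
  rw [← hs, detOf, h', sign_zero]

end Points

/-! ### Bit codes for cells and the verification of the ridge criterion -/

section Masks

/-- The labels ordered by their kinds. -/
def labelOrder : List (Fin 17) := [1, 5, 2, 6, 9, 13, 10, 14, 3, 7, 4, 8, 11, 15, 12, 16, 0]

/-- The labels in the set encoded by the first 17 bits of a number. -/
def labels (m : ℕ) : List (Fin 17) := labelOrder.filter fun i => m.testBit i

/-- The set encoded by the first 17 bits of a number. -/
def cell (m : ℕ) : Finset (Fin 17) := univ.filter fun i => m.testBit i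

/-- The first 17 bits of a number. -/
def support (m : ℕ) : ℕ := m &&& 131071

theorem mem_cell {m : ℕ} {i : Fin 17} : i ∈ cell m ↔ m.testBit i = true := by
  simp [cell]

theorem mem_labels {m : ℕ} {i : Fin 17} : i ∈ labels m ↔ m.testBit i = true := by
  have h : ∀ i, i ∈ labelOrder := by decide
  simp [labels, h i]

theorem nodup_labels (m : ℕ) : (labels m).Nodup :=
  List.Nodup.filter _ (by decide)

theorem toFinset_labels (m : ℕ) : (labels m).toFinset = cell m := by
  ext i
  rw [List.mem_toFinset, mem_labels, mem_cell]

theorem card_cell_eq (m : ℕ) : #(cell m) = (labels m).length := by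
  rw [← toFinset_labels, List.toFinset_card_of_nodup (nodup_labels m)]

theorem testBit_support (m : ℕ) (i : Fin 17) : (support m).testBit i = m.testBit i := by
  rw [support, Nat.testBit_and, show (131071 : ℕ) = 2 ^ 17 - 1 by norm_num,
    Nat.testBit_two_pow_sub_one]
  simp

theorem cell_support (m : ℕ) : cell (support m) = cell m := by
  ext i
  rw [mem_cell, mem_cell, testBit_support]

theorem labels_support (m : ℕ) : labels (support m) = labels m := by
  simp only [labels, testBit_support]

theorem testBit_xor_two_pow (m : ℕ) (i j : Fin 17) :
    (m ^^^ 2 ^ (i : ℕ)).testBit j = (m.testBit j ^^ decide (j = i)) := by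
  rw [Nat.testBit_xor, Nat.testBit_two_pow]
  congr 1
  simp [Fin.ext_iff, eq_comm]

theorem cell_xor_of_mem {m : ℕ} {i : Fin 17} (h : m.testBit i = true) :
    cell (m ^^^ 2 ^ (i : ℕ)) = (cell m).erase i := by
  ext j
  rw [mem_cell, Finset.mem_erase, mem_cell, testBit_xor_two_pow]
  by_cases hj : j = i
  · simp [hj, h]
  · simp [hj]

theorem cell_xor_of_notMem {m : ℕ} {i : Fin 17} (h : m.testBit i = false) :
    cell (m ^^^ 2 ^ (i : ℕ)) = insert i (cell m) := by
  ext j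
  rw [mem_cell, Finset.mem_insert, mem_cell, testBit_xor_two_pow]
  by_cases hj : j = i
  · simp [hj, h]
  · simp [hj]

theorem xor_xor_two_pow (m : ℕ) (i : Fin 17) : m ^^^ 2 ^ (i : ℕ) ^^^ 2 ^ (i : ℕ) = m := by
  rw [Nat.xor_assoc, Nat.xor_self, Nat.xor_zero]

theorem labels_xor {m : ℕ} {i : Fin 17} (h : m.testBit i = true) :
    labels (m ^^^ 2 ^ (i : ℕ)) = (labels m).erase i := by
  rw [(nodup_labels m).erase_eq_filter, labels, labels, List.filter_filter]
  refine List.filter_congr fun j _ => ?_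
  rw [testBit_xor_two_pow]
  by_cases hj : j = i
  · simp [hj, h]
  · simp [hj]

theorem support_and_eq {ρ m : ℕ} (h : cell ρ ⊆ cell m) : m &&& support ρ = support ρ := by
  refine Nat.eq_of_testBit_eq fun k => ?_
  rw [Nat.testBit_and]
  by_cases hk : k < 17
  · have h1 := testBit_support ρ ⟨k, hk⟩
    have h2 := @h ⟨k, hk⟩
    rw [mem_cell, mem_cell] at h2
    simp only at h1 h2
    rw [h1]
    cases hb : ρ.testBit k
    · simp
    · simp [h2 hb]
  · have : (support ρ).testBit k = false := by
      rw [support, Nat.testBit_and, show (131071 : ℕ) = 2 ^ 17 - 1 by norm_num,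
        Nat.testBit_two_pow_sub_one]
      simp [hk]
    simp [this]

/-- The sign `-1` for `true`, and `1` for `false`. -/
def boolSign (b : Bool) : SignType := bif b then -1 else 1

theorem boolSign_ne_zero (b : Bool) : boolSign b ≠ 0 := by cases b <;> decide

theorem boolSign_xor (a b : Bool) : boolSign (a ^^ b) = boolSign a * boolSign b := by
  cases a <;> cases b <;> decide

theorem boolSign_mul_self (a : Bool) : boolSign a * boolSign a = 1 := by
  cases a <;> decide

/-- Whether the position of a label in a set is odd. -/
def isOdd (m : ℕ) (i : Fin 17) : Bool := (labels m).idxOf i % 2 == 1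

/-- Moving an entry from position k to the front is a cycle of sign (-1)ᵏ. -/
theorem detOf_cons_erase {d : ℕ} (A : Fin 17 → Fin d → ℝ) {l : List (Fin 17)} {i : Fin 17}
    (hi : i ∈ l) (hl : l.length = d + 1) :
    detOf A (i :: l.erase i) = (-1) ^ l.idxOf i * detOf A l := by
  have hk : l.idxOf i < d + 1 := hl ▸ List.idxOf_lt_length_of_mem hi
  set k : Fin (d + 1) := ⟨l.idxOf i, hk⟩ with hkdef
  have h := Matrix.det_permute' k.cycleRange.symm (Matrix.of fun r c : Fin (d + 1) =>
    (Fin.cons (1 : ℝ) (A (l.getD c 0)) : Fin (d + 1) → ℝ) r)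
  have hsign : (((Equiv.Perm.sign k.cycleRange.symm : ℤˣ) : ℤ) : ℝ) = (-1) ^ l.idxOf i := by
    rw [Equiv.Perm.sign_symm, Fin.sign_cycleRange]
    push_cast
    rfl
  rw [hsign] at h
  rw [detOf, detOf, orientDet, orientDet, ← h]
  congr 1
  ext r c
  rw [Matrix.submatrix_apply, Matrix.of_apply, Matrix.of_apply]
  refine congrArg (fun q => (Fin.cons (1 : ℝ) (A q) : Fin (d + 1) → ℝ) r) ?_
  refine Fin.cases ?_ (fun j => ?_) c
  · rw [Fin.cycleRange_symm_zero]
    simp [hkdef, List.getD_eq_getElem?_getD, List.getElem?_idxOf hi]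
  · rw [Fin.cycleRange_symm_succ, Fin.val_succ, List.getD_cons_succ,
      List.erase_eq_eraseIdx_of_idxOf (i := l.idxOf i) rfl]
    have hj : (k.succAbove j : ℕ) = if (j : ℕ) < k then (j : ℕ) else j + 1 := by
      rw [Fin.succAbove]
      simp only [Fin.lt_def, Fin.val_castSucc]
      split_ifs <;> simp
    rw [hj, List.getD_eq_getElem?_getD, List.getD_eq_getElem?_getD, List.getElem?_eraseIdx]
    simp only [hkdef]
    split_ifs <;> rfl

variable {A : Fin 17 → Fin 6 → ℝ}

theorem sign_detOf_cons (hA : HasCertSigns A) {m : ℕ} {i : Fin 17} (hi : m.testBit i = true)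
    (hl : (labels m).length = 7) (h : certSign (labels m) ≠ 0) :
    SignType.sign (detOf A (i :: labels (m ^^^ 2 ^ (i : ℕ)))) =
      boolSign (isOdd m i) * certSign (labels m) := by
  rw [labels_xor hi, detOf_cons_erase A (mem_labels.2 hi) hl, sign_mul, hA _ h]
  congr 1
  rw [isOdd]
  rcases Nat.mod_two_eq_zero_or_one ((labels m).idxOf i) with h | h
  · rw [h, (Nat.even_iff.2 h).neg_one_pow]; simp [boolSign]
  · rw [h, (Nat.odd_iff.2 h).neg_one_pow]; simp [boolSign]

theorem cons_getD (x : Fin 17) (l : List (Fin 17)) :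
    (Fin.cons x (fun k : Fin 6 => l.getD k 0) : Fin 7 → Fin 17) =
      fun k : Fin 7 => (x :: l).getD k 0 := by
  ext k
  refine Fin.cases ?_ (fun j => ?_) k
  · rfl
  · simp

theorem length_labels_xor {m : ℕ} {i : Fin 17} (hi : m.testBit i = true)
    (hl : (labels m).length = 7) : (labels (m ^^^ 2 ^ (i : ℕ))).length = 6 := by
  rw [labels_xor hi, List.length_erase_of_mem (mem_labels.2 hi), hl]

theorem injective_getD {l : List (Fin 17)} (hl : l.length = 6) (hn : l.Nodup) :
    Function.Injective fun k : Fin 6 => l.getD k 0 := by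
  intro a b hab
  have ha : (a : ℕ) < l.length := by rw [hl]; exact a.2
  have hb : (b : ℕ) < l.length := by rw [hl]; exact b.2
  simp only [List.getD_eq_getElem l 0 ha, List.getD_eq_getElem l 0 hb] at hab
  exact Fin.ext (hn.getElem_inj_iff.1 hab)

theorem image_getD {l : List (Fin 17)} (hl : l.length = 6) :
    univ.image (fun k : Fin 6 => l.getD k 0) = l.toFinset := by
  ext x
  rw [Finset.mem_image, List.mem_toFinset, List.mem_iff_getElem]
  constructor
  · rintro ⟨k, _, rfl⟩
    have hk : (k : ℕ) < l.length := by rw [hl]; exact k.2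
    exact ⟨k, hk, (List.getD_eq_getElem l 0 hk).symm⟩
  · rintro ⟨k, hk, rfl⟩
    exact ⟨⟨k, hl ▸ hk⟩, Finset.mem_univ _, List.getD_eq_getElem _ _ _⟩

/-- Cramer's rule for signs: the side of a ridge on which a point lies is read off from two
determinants. -/
theorem IsBary.sign_apply {m : ℕ} {b : Fin 17 → (Fin 6 → ℝ) →ᵃ[ℝ] ℝ} (hb : IsBary A (cell m) b)
    {i : Fin 17} (hi : m.testBit i = true) (hl : (labels m).length = 7) (j : Fin 17) :
    SignType.sign (detOf A (j :: labels (m ^^^ 2 ^ (i : ℕ)))) =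
      SignType.sign (b i (A j)) * SignType.sign (detOf A (i :: labels (m ^^^ 2 ^ (i : ℕ)))) := by
  have hl6 := length_labels_xor hi hl
  have h := hb.orientDet_cons (mem_cell.2 hi) (injective_getD hl6 (nodup_labels _))
    (by rw [image_getD hl6, toFinset_labels, cell_xor_of_mem hi]) j
  rw [cons_getD, cons_getD] at h
  rw [detOf, detOf, h, sign_mul]

/-- The orientation of a cell relative to the orientation of the ridge opposite to `i`. -/
def side (m : ℕ) (i : Fin 17) : Bool := m.testBit 17 ^^ isOdd m i

/-- Bit 17 of the code of a cell encodes its orientation. -/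
def isOriented (m : ℕ) : Bool :=
  (labels m).length == 7 && certSign (labels m) == boolSign (m.testBit 17)

/-- Bit 17 of the code of a ridge encodes the side that contains all the other points. -/
def isFacet (β : ℕ) : Bool :=
  labelOrder.all fun x => β.testBit x ||
    certSign (labels (β ^^^ 2 ^ (x : ℕ))) == boolSign (side (β ^^^ 2 ^ (x : ℕ)) x)

/-- The cell with code `n` contains the ridge of the cell with code `m` opposite to `i` and lies on
the other side of it. -/
def isOpposite (m : ℕ) (i : Fin 17) (n : ℕ) : Bool :=
  -- For neighbouring cells the symmetric difference is {i, j}; after i and the orientation bit are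
  -- removed, the logarithm finds j.
  let j : Fin 17 := Fin.ofNat 17 (support (m ^^^ n ^^^ 2 ^ (i : ℕ))).log2
  !m.testBit j && support n == support (m ^^^ 2 ^ (i : ℕ) ^^^ 2 ^ (j : ℕ)) && side m i != side n j

/-- The codes of `L` whose cells contain the ridge with code `ρ`. -/
noncomputable def star (L : List ℕ) (ρ : ℕ) : List ℕ :=
  List.rec [] (fun n _ S => cond (Nat.beq (Nat.land n ρ) ρ) (n :: S) S) L

theorem mem_star {L : List ℕ} {ρ n : ℕ} : n ∈ star L ρ ↔ n ∈ L ∧ n &&& ρ = ρ := by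
  induction L with
  | nil => simp [star]
  | cons k L ih =>
    have h : star (k :: L) ρ = cond (Nat.beq (k &&& ρ) ρ) (k :: star L ρ) (star L ρ) := rfl
    cases hk : Nat.beq (k &&& ρ) ρ
    · have := Nat.ne_of_beq_eq_false hk
      rw [h, hk, cond_false, ih, List.mem_cons]
      exact ⟨fun h => ⟨Or.inr h.1, h.2⟩, fun h => ⟨h.1.resolve_left (by rintro rfl; exact this h.2),
        h.2⟩⟩
    · have := Nat.eq_of_beq_eq_true hk
      rw [h, hk, cond_true, List.mem_cons, ih, List.mem_cons]
      exact ⟨fun h => h.elim (by rintro rfl; exact ⟨Or.inl rfl, this⟩) fun h => ⟨Or.inr h.1, h.2⟩,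
        fun h => h.1.imp_right fun h' => ⟨h', h.2⟩⟩

/-- A ridge that is contained in one cell only is in the list `B`. -/
def isBoundary (B : List ℕ) (ρ m : ℕ) (S : List ℕ) : Bool :=
  S.all (· == m) && B.any fun β => support β == ρ

/-- Each ridge of the cell with code `m` is a boundary ridge or a ridge between two cells. -/
noncomputable def ridgesOk (L B : List ℕ) (m : ℕ) : Bool :=
  (labels m).all fun i =>
    let S := star L (support (m ^^^ 2 ^ (i : ℕ)))
    isBoundary B (support (m ^^^ 2 ^ (i : ℕ))) m S ||
      S.any fun n => isOpposite m i n && S.all fun k => k == m || k == n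

/-- The set of cells given by a list of codes. -/
def cells (L : List ℕ) : Finset (Finset (Fin 17)) := (L.map cell).toFinset

theorem mem_cells {L : List ℕ} {σ : Finset (Fin 17)} : σ ∈ cells L ↔ ∃ m ∈ L, cell m = σ := by
  simp [cells]

theorem isOriented.sign_detOf (hA : HasCertSigns A) {m : ℕ} (hm : isOriented m = true)
    {i : Fin 17} (hi : m.testBit i = true) :
    SignType.sign (detOf A (i :: labels (m ^^^ 2 ^ (i : ℕ)))) = boolSign (side m i) := by
  rw [isOriented, Bool.and_eq_true, beq_iff_eq, beq_iff_eq] at hm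
  rw [sign_detOf_cons hA hi hm.1 (hm.2 ▸ boolSign_ne_zero _), hm.2, side, boolSign_xor, mul_comm]

/-- The certificate is for sorted labels. Moving x to the front contributes the parity that `side`
contains, so the two parities cancel and only bit 17 is left. -/
theorem isFacet.sign_detOf (hA : HasCertSigns A) {β : ℕ} (hβ : isFacet β = true)
    (hl : (labels β).length = 6) {x : Fin 17} (hx : β.testBit x = false) :
    SignType.sign (detOf A (x :: labels β)) = boolSign (β.testBit 17) := by
  have hmem : ∀ x, x ∈ labelOrder := by decide
  have h := List.all_eq_true.1 hβ x (hmem x)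
  rw [hx, Bool.false_or, beq_iff_eq] at h
  have hx' : (β ^^^ 2 ^ (x : ℕ)).testBit x = true := by
    rw [testBit_xor_two_pow, hx]; simp
  have hβ' := xor_xor_two_pow β x
  have hl' : (labels (β ^^^ 2 ^ (x : ℕ))).length = 7 := by
    have := labels_xor hx'
    rw [hβ'] at this
    rw [this, List.length_erase_of_mem (mem_labels.2 hx')] at hl
    omega
  have hs := sign_detOf_cons hA hx' hl' (h ▸ boolSign_ne_zero _)
  have h17 : (β ^^^ 2 ^ (x : ℕ)).testBit 17 = β.testBit 17 := by
    rw [Nat.testBit_xor, Nat.testBit_two_pow]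
    simp [x.2.ne]
  rw [hβ', h, side, boolSign_xor, h17, mul_left_comm, boolSign_mul_self, mul_one] at hs
  exact hs

theorem exists_isOpposite {m n : ℕ} {i : Fin 17} (h : isOpposite m i n = true)
    (hi : m.testBit i = true) : ∃ j : Fin 17, m.testBit j = false ∧ n.testBit j = true ∧
      cell n = insert j ((cell m).erase i) ∧
      labels (n ^^^ 2 ^ (j : ℕ)) = labels (m ^^^ 2 ^ (i : ℕ)) ∧ side m i ≠ side n j := by
  unfold isOpposite at h
  simp only [Bool.and_eq_true, Bool.not_eq_true', beq_iff_eq, bne_iff_ne] at h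
  obtain ⟨⟨hj, hn⟩, hside⟩ := h
  refine ⟨_, hj, ?_, ?_, ?_, hside⟩
  all_goals generalize Fin.ofNat 17 (support (m ^^^ n ^^^ 2 ^ (i : ℕ))).log2 = j at *
  · rw [← testBit_support, hn, testBit_support, testBit_xor_two_pow, testBit_xor_two_pow, hj]
    have : j ≠ i := by rintro rfl; simp [hi] at hj
    simp [this]
  · rw [← cell_support, hn, cell_support, cell_xor_of_notMem, cell_xor_of_mem hi]
    rw [testBit_xor_two_pow, hj]
    have : j ≠ i := by rintro rfl; simp [hi] at hj
    simp [this]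
  · have hsup : ∀ k : Fin 17, n.testBit k = (m ^^^ 2 ^ (i : ℕ) ^^^ 2 ^ (j : ℕ)).testBit k := by
      intro k
      rw [← testBit_support, hn, testBit_support]
    simp only [labels]
    refine List.filter_congr fun k _ => ?_
    rw [testBit_xor_two_pow, hsup, testBit_xor_two_pow, Bool.xor_assoc, Bool.xor_self,
      Bool.xor_false]

/-- The cells of a list of codes form a triangulation if the orientations of the cells and of the
boundary ridges are certified, and the ridges match. -/
theorem isTriangulation_cells (hGP : InGeneralPosition A) (hA : HasCertSigns A) {L B : List ℕ}
    (hL : L.all isOriented = true) (hB : B.all isFacet = true)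
    (hR : L.all (ridgesOk L B) = true)
    (hex : ∃ m ∈ L, ∃ i : Fin 17, m.testBit i = true ∧
      isBoundary B (support (m ^^^ 2 ^ (i : ℕ))) m
        (star L (support (m ^^^ 2 ^ (i : ℕ)))) = true) :
    IsTriangulation A (cells L) := by
  have hι : 6 + 1 ≤ Fintype.card (Fin 17) := by simp
  rw [List.all_eq_true] at hL hB hR
  have hlen : ∀ m ∈ L, (labels m).length = 7 := by
    intro m hm
    have := hL m hm
    rw [isOriented, Bool.and_eq_true, beq_iff_eq] at this
    exact this.1
  have hcard : ∀ m ∈ L, #(cell m) = 7 := fun m hm => by rw [card_cell_eq, hlen m hm]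
  have hb' : ∀ σ ∈ cells L, ∃ b, IsBary A σ b := by
    intro σ hσ
    obtain ⟨m, hm, rfl⟩ := mem_cells.1 hσ
    exact exists_isBary (hGP.affineIndependent_of_card_eq (hcard m hm)) (hcard m hm)
  choose! b hb using hb'
  have hstar : ∀ (m : ℕ) (i : Fin 17) τ, τ ∈ cells L → (cell (m ^^^ 2 ^ (i : ℕ))) ⊆ τ →
      ∃ n ∈ star L (support (m ^^^ 2 ^ (i : ℕ))), cell n = τ := by
    intro m i τ hτ hsub
    obtain ⟨n, hn, rfl⟩ := mem_cells.1 hτ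
    exact ⟨n, mem_star.2 ⟨hn, support_and_eq hsub⟩, rfl⟩
  have hbd : ∀ m ∈ L, ∀ i : Fin 17, m.testBit i = true →
      isBoundary B (support (m ^^^ 2 ^ (i : ℕ))) m
        (star L (support (m ^^^ 2 ^ (i : ℕ)))) = true →
      IsBoundaryRidge A (cells L) b (cell m) i := by
    intro m hm i hi h
    rw [isBoundary, Bool.and_eq_true, List.all_eq_true, List.any_eq_true] at h
    obtain ⟨hS, β, hβ, hρ⟩ := h
    rw [beq_iff_eq] at hρ
    have hlab : labels β = labels (m ^^^ 2 ^ (i : ℕ)) := by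
      rw [← labels_support, hρ, labels_support]
    have hl6 := length_labels_xor hi (hlen m hm)
    have hmem : ∀ x : Fin 17, β.testBit x = (m ^^^ 2 ^ (i : ℕ)).testBit x := fun x => by
      rw [← testBit_support, hρ, testBit_support]
    have hsg := fun x hx => isFacet.sign_detOf hA (hB β hβ) (by rw [hlab, hl6]) (x := x) hx
    rw [hlab] at hsg
    refine ⟨fun j hj => ?_, fun τ hτ hsub => ?_⟩
    · have h1 := (hb (cell m) (mem_cells.2 ⟨m, hm, rfl⟩)).sign_apply hi (hlen m hm) j
      have hj' : m.testBit j = false := by simpa [mem_cell] using hj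
      -- The apex i and the point j have the same sign relative to the ridge, so the coordinate is
      -- positive.
      rw [hsg j (by rw [hmem, testBit_xor_two_pow, hj']; simp; rintro rfl; simp [hi] at hj'),
        hsg i (by rw [hmem, testBit_xor_two_pow, hi]; simp)] at h1
      rw [← sign_eq_one_iff]
      generalize SignType.sign (b (cell m) i (A j)) = s at h1
      revert h1
      cases β.testBit 17 <;> revert s <;> decide
    · rw [← cell_xor_of_mem hi] at hsub
      obtain ⟨n, hn, rfl⟩ := hstar m i τ hτ hsub
      rw [beq_iff_eq.1 (hS n hn)]
  have hPM : IsPseudoManifold A (cells L) b := by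
    refine ⟨hb, ?_, ?_⟩
    · intro σ hσ i hi
      obtain ⟨m, hm, rfl⟩ := mem_cells.1 hσ
      rw [mem_cell] at hi
      have h := hR m hm
      rw [ridgesOk, List.all_eq_true] at h
      have h := h i (mem_labels.2 hi)
      simp only [Bool.or_eq_true, List.any_eq_true, Bool.and_eq_true, List.all_eq_true,
        beq_iff_eq] at h
      rcases h with h | ⟨n, hn, hopp, hS⟩
      · exact Or.inr (hbd m hm i hi h)
      · left
        obtain ⟨j, hjm, hjn, hcell, hlab, hside⟩ := exists_isOpposite hopp hi
        have hnL : n ∈ L := (mem_star.1 hn).1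
        refine ⟨j, by simp [mem_cell, hjm], hcell ▸ mem_cells.2 ⟨n, hnL, rfl⟩, ?_, ?_⟩
        -- The two apices have opposite signs relative to the same ordered ridge, so the coordinate
        -- is negative.
        · have h1 := (hb (cell m) (mem_cells.2 ⟨m, hm, rfl⟩)).sign_apply hi (hlen m hm) j
          rw [isOriented.sign_detOf hA (hL m hm) hi, ← hlab,
            isOriented.sign_detOf hA (hL n hnL) hjn] at h1
          rw [← sign_eq_neg_one_iff]
          generalize SignType.sign (b (cell m) i (A j)) = s at h1
          revert h1 hside
          cases side m i <;> cases side n j <;> revert s <;> decide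
        · intro τ hτ hsub
          rw [← cell_xor_of_mem hi] at hsub
          obtain ⟨k, hk, rfl⟩ := hstar m i τ hτ hsub
          rcases hS k hk with rfl | rfl
          · exact Or.inl rfl
          · exact Or.inr hcell
    · obtain ⟨m, hm, i, hi, h⟩ := hex
      refine ⟨cell m, mem_cells.2 ⟨m, hm, rfl⟩, i, mem_cell.2 hi, ?_, hbd m hm i hi h⟩
      rw [← Finset.card_pos, Finset.card_erase_of_mem (mem_cell.2 hi), hcard m hm]
      norm_num
  have hcard' : ∀ σ ∈ cells L, #σ = 6 + 1 := by
    intro σ hσ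
    obtain ⟨m, hm, rfl⟩ := mem_cells.1 hσ
    exact hcard m hm
  refine ⟨fun σ hσ => hGP.affineIndependent_of_card_eq (hcard' σ hσ), fun σ hσ => ?_,
    fun σ hσ τ hτ => ⟨hPM.isExposed_inter hσ hτ, ?_⟩, hPM.cover⟩
  · rw [hGP.affineSpan_eq_top (hcard' σ hσ), hGP.affineSpan_range_eq_top hι]
  · rw [Set.inter_comm]
    exact hPM.isExposed_inter hτ hσ

end Masks

/-! ### The 64 locked cells -/

section Locked

/-- The labels of the points that span one of the coordinate planes, in cyclic order. -/
def firstLabel (i : ℕ) : Fin 17 := ([1, 5, 2, 6, 9, 13, 10, 14] : List (Fin 17)).getD (i % 8) 0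

/-- The labels of the points that span the other coordinate plane, in cyclic order. -/
def secondLabel (j : ℕ) : Fin 17 := ([3, 7, 4, 8, 11, 15, 12, 16] : List (Fin 17)).getD (j % 8) 0

/-- The cell of `O` and three consecutive points from each of the two coordinate planes. -/
def lockMask (i j : ℕ) : ℕ :=
  1 + 2 ^ (firstLabel i : ℕ) + 2 ^ (firstLabel (i + 1) : ℕ) + 2 ^ (firstLabel (i + 2) : ℕ) +
    2 ^ (secondLabel j : ℕ) + 2 ^ (secondLabel (j + 1) : ℕ) + 2 ^ (secondLabel (j + 2) : ℕ)

/-- The codes of the cells of `lockMask`. -/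
def lockMasks : List ℕ :=
  (List.range 8).flatMap fun i => (List.range 8).map fun j => lockMask i j

/-- Exchanges of a vertex by another one that lead from `lockMask i j` to another such cell. -/
def lockExchanges (i j : ℕ) : List ((Fin 17 × Fin 17) × (ℕ × ℕ)) :=
  [((firstLabel i, firstLabel (i + 3)), ((i + 1) % 8, j)),
    ((firstLabel (i + 2), firstLabel (i + 7)), ((i + 7) % 8, j)),
    ((secondLabel j, secondLabel (j + 3)), (i, (j + 1) % 8)),
    ((secondLabel (j + 2), secondLabel (j + 7)), (i, (j + 7) % 8))]

/-- The certified sign of `x` with respect to the ridge opposite to `e`. -/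
def ridgeSign (m : ℕ) (x : Fin 17) : SignType :=
  boolSign (isOdd m x) * certSign (labels m)

/-- The exchange of `e` by `o` shows that `x` cannot be used in a flip of the cell with code `m`. -/
def isExchange (m : ℕ) (x e o : Fin 17) (n : ℕ) : Bool :=
  m.testBit e && !m.testBit o && o != x && n == m ^^^ 2 ^ (e : ℕ) ^^^ 2 ^ (o : ℕ) &&
    (labels m).length == 7 &&
    ridgeSign (m ^^^ 2 ^ (e : ℕ) ^^^ 2 ^ (x : ℕ)) x * ridgeSign m e == -1 &&
    ridgeSign (m ^^^ 2 ^ (e : ℕ) ^^^ 2 ^ (x : ℕ)) x *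
      ridgeSign (m ^^^ 2 ^ (e : ℕ) ^^^ 2 ^ (o : ℕ)) o == 1

/-- All points that are not vertices of the cells of `lockMask` are excluded by an exchange. -/
def isLockedCheck : Bool :=
  (List.range 8).all fun i => (List.range 8).all fun j => labelOrder.all fun x =>
    (lockMask i j).testBit x || (lockExchanges i j).any fun q =>
      decide (q.2.1 < 8) && decide (q.2.2 < 8) &&
        isExchange (lockMask i j) x q.1.1 q.1.2 (lockMask q.2.1 q.2.2)

variable {A : Fin 17 → Fin 6 → ℝ}

theorem sign_detOf_of_ridgeSign (hA : HasCertSigns A) {m : ℕ} {x : Fin 17}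
    (hx : m.testBit x = true) (hl : (labels m).length = 7) (h : ridgeSign m x ≠ 0) :
    SignType.sign (detOf A (x :: labels (m ^^^ 2 ^ (x : ℕ)))) = ridgeSign m x :=
  sign_detOf_cons hA hx hl fun h' => h (by rw [ridgeSign, h', mul_zero])

theorem length_labels_xor_of_notMem {m : ℕ} {x : Fin 17} (hx : m.testBit x = false)
    (hl : (labels m).length = 6) : (labels (m ^^^ 2 ^ (x : ℕ))).length = 7 := by
  rw [← card_cell_eq, cell_xor_of_notMem hx, Finset.card_insert_of_notMem (by simp [mem_cell, hx]),
    card_cell_eq, hl]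

theorem mem_cells_lockMasks {i j : ℕ} (hi : i < 8) (hj : j < 8) :
    cell (lockMask i j) ∈ cells lockMasks := by
  refine mem_cells.2 ⟨lockMask i j, ?_, rfl⟩
  exact List.mem_flatMap.2 ⟨i, List.mem_range.2 hi, List.mem_map.2 ⟨j, List.mem_range.2 hj, rfl⟩⟩

theorem isLocked_of_check (hA : HasCertSigns A) (h : isLockedCheck = true) :
    IsLocked A (cells lockMasks) := by
  intro κ hκ x hx
  obtain ⟨m, hm, rfl⟩ := mem_cells.1 hκ
  obtain ⟨i, hi, hm⟩ := List.mem_flatMap.1 hm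
  obtain ⟨j, hj, rfl⟩ := List.mem_map.1 hm
  have hmem : ∀ x, x ∈ labelOrder := by decide
  have h := List.all_eq_true.1 (List.all_eq_true.1 (List.all_eq_true.1 h i hi) j hj) x (hmem x)
  have hx' : (lockMask i j).testBit x = false := by simpa [mem_cell] using hx
  rw [hx', Bool.false_or, List.any_eq_true] at h
  obtain ⟨⟨⟨e, o⟩, i', j'⟩, -, h⟩ := h
  simp only [isExchange, Bool.and_eq_true, decide_eq_true_eq, Bool.not_eq_true', bne_iff_ne,
    beq_iff_eq] at h
  obtain ⟨⟨hi', hj'⟩, ⟨⟨⟨⟨⟨he, ho⟩, hox⟩, hn⟩, hl⟩, hneg⟩, hpos⟩ := h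
  generalize lockMask i j = m at *
  have hl6 := length_labels_xor he hl
  have hbit : ∀ y : Fin 17, m.testBit y = false → (m ^^^ 2 ^ (e : ℕ)).testBit y = false := by
    intro y hy
    have : y ≠ e := by rintro rfl; simp [he] at hy
    rw [testBit_xor_two_pow, hy]
    simp [this]
  have hsign : ∀ y : Fin 17, m.testBit y = false →
      ridgeSign (m ^^^ 2 ^ (e : ℕ) ^^^ 2 ^ (y : ℕ)) y ≠ 0 →
      SignType.sign (detOf A (y :: labels (m ^^^ 2 ^ (e : ℕ)))) =
        ridgeSign (m ^^^ 2 ^ (e : ℕ) ^^^ 2 ^ (y : ℕ)) y := by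
    intro y hy hne
    have := sign_detOf_of_ridgeSign hA (m := m ^^^ 2 ^ (e : ℕ) ^^^ 2 ^ (y : ℕ)) (x := y)
      (by rw [testBit_xor_two_pow, hbit y hy]; simp) (length_labels_xor_of_notMem (hbit y hy) hl6)
      hne
    rwa [xor_xor_two_pow] at this
  -- A product equal to ±1 has non-zero factors, so all three signs are certified and hold for A.
  have hx0 : ridgeSign (m ^^^ 2 ^ (e : ℕ) ^^^ 2 ^ (x : ℕ)) x ≠ 0 := by
    intro h0; rw [h0, zero_mul] at hneg; revert hneg; decide
  have ho0 : ridgeSign (m ^^^ 2 ^ (e : ℕ) ^^^ 2 ^ (o : ℕ)) o ≠ 0 := by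
    intro h0; rw [h0, mul_zero] at hpos; revert hpos; decide
  have he0 : ridgeSign m e ≠ 0 := by
    intro h0; rw [h0, mul_zero] at hneg; revert hneg; decide
  refine ⟨e, mem_cell.2 he, o, by simp [mem_cell, ho], hox, ?_,
    fun k => (labels (m ^^^ 2 ^ (e : ℕ))).getD k 0, injective_getD hl6 (nodup_labels _), ?_, ?_, ?_⟩
  · rw [← cell_xor_of_mem he, ← cell_xor_of_notMem (hbit o ho), ← hn]
    exact mem_cells_lockMasks hi' hj'
  · rw [image_getD hl6, toFinset_labels, cell_xor_of_mem he]
  · rw [cons_getD, cons_getD, ← sign_eq_neg_one_iff, sign_mul]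
    exact (congrArg₂ (· * ·) (hsign x hx' hx0) (sign_detOf_of_ridgeSign hA he hl he0)).trans hneg
  · rw [cons_getD, cons_getD, ← sign_eq_one_iff, sign_mul]
    exact (congrArg₂ (· * ·) (hsign x hx' hx0) (hsign o ho ho0)).trans hpos

end Locked

/-! ### The two triangulations and their finite checks -/

section Data

set_option maxRecDepth 10000

/-- The codes of the cells of a triangulation of `config17 t` for small `t` that contains all the
cells of `lockMask`. -/
def lockedCells : List ℕ :=
  [191, 131325, 131454, 131487, 131511, 131518, 131559, 494, 501, 508, 733, 911, 131997, 132053,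
  132383, 1435, 1466, 1807, 132893, 1931, 133017, 2111, 2359, 133493, 2422, 2901, 3103, 134203,
  3351, 3613, 3847, 3861, 135293, 6191, 6205, 137333, 7183, 138283, 138297, 7693, 139513, 139740,
  8797, 139993, 8924, 9116, 9169, 140244, 9881, 141201, 141208, 141853, 10837, 142161, 11801,
  12049, 12381, 143481, 12521, 143949, 144076, 14365, 14421, 145521, 145933, 14917, 15385, 15881,
  147643, 16819, 16881, 17467, 17563, 17594, 148883, 148914, 148920, 149811, 19507, 19731, 152619,
  21561, 152746, 23587, 23601, 155833, 24817, 25041, 156825, 26001, 26008, 157464, 157569, 26504,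
  158993, 28432, 159801, 28841, 159969, 160793, 161841, 162833, 164199, 164323, 166183, 35158,
  35173, 166246, 35185, 166258, 166663, 166725, 166740, 167683, 38951, 170085, 39493, 41812,
  41921, 43121, 43345, 174676, 43841, 43856, 175873, 178273, 178753, 47684, 48641, 180593, 49571,
  49633, 50482, 51491, 182577, 51506, 183346, 183555, 183570, 53008, 186403, 56323, 56354, 57457,
  188753, 57793, 189313, 190209, 59441, 59665, 191248, 60673, 192256, 61537, 194593, 195585,
  196783, 65767, 65773, 196846, 65991, 197263, 197325, 197511, 197573, 198159, 198283, 198531,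
  69127, 69679, 200813, 69742, 69838, 69865, 200938, 70221, 201420, 70671, 71181, 202854, 203783,
  204293, 74441, 206473, 78025, 209481, 78532, 78536, 79369, 82091, 214155, 214403, 83841, 217131,
  217257, 86186, 217313, 87051, 218250, 87202, 87688, 91273, 91777, 222856, 94345, 225473, 225928,
  226313, 95752, 228864, 229479, 229603, 98631, 98755, 230151, 230213, 99265, 231171, 100454,
  100871, 101891, 233511, 102501, 234053, 235527, 235558, 104548, 236037, 105475, 105506, 237057,
  107201, 111169, 242244, 243201, 243780, 113156, 245248, 114851, 114913, 246147, 115585, 247043,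
  116481, 118819, 118881, 250883, 250914, 252960, 123073, 254593, 255489, 126464, 127041, 128001,
  130048]

/-- The codes of the cells of another triangulation of `config17 t` for small `t`. -/
def otherCells : List ℕ :=
  [131199, 351, 131451, 131535, 491, 131577, 911, 132383, 1339, 132523, 1807, 132893, 1931, 2111,
  133239, 3103, 134203, 3351, 3613, 3847, 3861, 4207, 135293, 4303, 135403, 5291, 6191, 6205,
  137319, 137333, 7183, 138283, 138297, 7693, 139513, 139613, 8653, 139737, 8989, 140173, 9157,
  141853, 11801, 12381, 143481, 143565, 12521, 12941, 14365, 14421, 145521, 145933, 15385, 15881,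
  16825, 16881, 148793, 17827, 17833, 18201, 149385, 21561, 152745, 22153, 23601, 155833, 24817,
  156057, 25041, 156441, 25481, 157209, 159249, 159801, 28841, 159969, 160393, 160793, 30217,
  161841, 162833, 163329, 164183, 33139, 164323, 165171, 34903, 166003, 35095, 166663, 35605,
  35891, 167187, 167683, 36625, 41301, 172821, 41797, 41921, 174165, 43121, 43541, 178273, 180593,
  49571, 49633, 50467, 50481, 182033, 183345, 52753, 57457, 188753, 57793, 58129, 189313, 59441,
  190993, 61537, 194593, 65991, 197263, 197511, 197573, 198159, 198283, 198531, 69127, 69775,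
  200903, 69859, 70285, 70671, 201867, 201891, 71181, 71305, 71751, 202851, 203783, 72739, 204293,
  205509, 78021, 209541, 211013, 80389, 214179, 214403, 83841, 217313, 87201, 218753, 220193,
  89601, 225473, 94849, 227841, 229603, 98631, 98755, 230151, 230213, 99265, 231171, 231495,
  100451, 100871, 232483, 101891, 235617, 107077, 107201, 108613, 240133, 243777, 114851, 114913,
  246147, 115585, 115747, 247043, 116481, 117793, 249345, 118881, 120865, 123073, 254593, 125441,
  127041, 260097]

/-- The codes of the facets of the convex hull of `config17 t` for small `t`. -/
def boundaryRidges : List ℕ :=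
  [131198, 350, 131450, 131534, 490, 131576, 910, 132382, 1338, 132522, 1806, 132892, 1930, 2110,
  133238, 3102, 134202, 3350, 3612, 3846, 3860, 4206, 135292, 4302, 135402, 5290, 6190, 6204,
  137318, 137332, 7182, 138282, 138296, 7692, 139512, 139612, 8652, 139736, 8988, 140172, 9156,
  141852, 11800, 12380, 143480, 143564, 12520, 12940, 14364, 14420, 145520, 145932, 15384, 15880,
  16824, 16880, 148792, 17826, 17832, 18200, 149384, 21560, 152744, 22152, 23600, 155832, 24816,
  156056, 25040, 156440, 25480, 157208, 159248, 159800, 28840, 159968, 160392, 160792, 30216,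
  161840, 162832, 163328, 164182, 33138, 164322, 165170, 34902, 166002, 35094, 166662, 35604,
  35890, 167186, 167682, 36624, 41300, 172820, 41796, 41920, 174164, 43120, 43540, 178272, 180592,
  49570, 49632, 50466, 50480, 182032, 183344, 52752, 57456, 188752, 57792, 58128, 189312, 59440,
  190992, 61536, 194592, 65990, 197262, 197510, 197572, 198158, 198282, 198530, 69126, 69774,
  200902, 69858, 70284, 70670, 201866, 201890, 71180, 71304, 71750, 202850, 203782, 72738, 204292,
  205508, 78020, 209540, 211012, 80388, 214178, 214402, 83840, 217312, 87200, 218752, 220192,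
  89600, 225472, 94848, 227840, 229602, 98630, 98754, 230150, 230212, 99264, 231170, 231494,
  100450, 100870, 232482, 101890, 235616, 107076, 107200, 108612, 240132, 243776, 114850, 114912,
  246146, 115584, 115746, 247042, 116480, 117792, 249344, 118880, 120864, 123072, 254592, 125440,
  127040, 260096]

theorem isLockedCheck_eq : isLockedCheck = true := by decide +kernel

theorem isFacet_boundaryRidges : boundaryRidges.all isFacet = true := by decide +kernel

theorem isOriented_lockedCells : lockedCells.all isOriented = true := by decide +kernel

theorem isOriented_otherCells : otherCells.all isOriented = true := by decide +kernel

theorem ridgesOk_lockedCells : lockedCells.all (ridgesOk lockedCells boundaryRidges) = true := by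
  decide +kernel

/-- The codes of `otherCells` are those of `boundaryRidges` plus one, that is, with the bit of O
added: the cells form the cone from O over the boundary facets. -/
theorem ridgesOk_otherCells : otherCells.all (ridgesOk otherCells boundaryRidges) = true := by
  decide +kernel

end Data

/-! ### Conclusion -/

section Main

theorem support_eq_of_cell_eq {m n : ℕ} (h : cell m = cell n) : support m = support n := by
  have h1 := support_and_eq (ρ := support m) (m := support n) (by simp [cell_support, h])
  have h2 := support_and_eq (ρ := support n) (m := support m) (by simp [cell_support, h])
  have hs : ∀ k, support (support k) = support k := fun k => by
    rw [support, support, Nat.and_assoc, Nat.and_self]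
  rw [hs] at h1 h2
  rw [← h1, ← h2, Nat.and_comm, h2, h2]

theorem exists_isBoundary {L B : List ℕ} (h : (L.any fun m => (labels m).any fun i =>
    isBoundary B (support (m ^^^ 2 ^ (i : ℕ))) m (star L (support (m ^^^ 2 ^ (i : ℕ))))) = true) :
    ∃ m ∈ L, ∃ i : Fin 17, m.testBit i = true ∧
      isBoundary B (support (m ^^^ 2 ^ (i : ℕ))) m
        (star L (support (m ^^^ 2 ^ (i : ℕ)))) = true := by
  simp only [List.any_eq_true] at h
  obtain ⟨m, hm, i, hi, h⟩ := h
  exact ⟨m, hm, i, mem_labels.1 hi, h⟩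

theorem cells_lockMasks_subset : cells lockMasks ⊆ cells lockedCells := by
  have h : (lockMasks.all fun κ => lockedCells.any fun m => support m == κ) = true := by
    decide +kernel
  simp only [List.all_eq_true, List.any_eq_true, beq_iff_eq] at h
  intro σ hσ
  obtain ⟨κ, hκ, rfl⟩ := mem_cells.1 hσ
  obtain ⟨m, hm, rfl⟩ := h κ hκ
  exact mem_cells.2 ⟨m, hm, (cell_support m).symm⟩

theorem not_cells_lockMasks_subset : ¬ cells lockMasks ⊆ cells otherCells := by
  -- A single missing cell of the 64 suffices.
  have h : (otherCells.all fun m => support m != support (lockMask 0 0)) = true := by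
    decide +kernel
  simp only [List.all_eq_true, bne_iff_ne] at h
  intro hsub
  obtain ⟨m, hm, hm'⟩ := mem_cells.1 (hsub (mem_cells_lockMasks (i := 0) (j := 0)
    (by norm_num) (by norm_num)))
  exact h m hm (support_eq_of_cell_eq hm')

variable {A : Fin 17 → Fin 6 → ℝ}

theorem isTriangulation_lockedCells (hGP : InGeneralPosition A) (hA : HasCertSigns A) :
    IsTriangulation A (cells lockedCells) :=
  isTriangulation_cells hGP hA isOriented_lockedCells isFacet_boundaryRidges ridgesOk_lockedCells
    (exists_isBoundary (by decide +kernel))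

theorem isTriangulation_otherCells (hGP : InGeneralPosition A) (hA : HasCertSigns A) :
    IsTriangulation A (cells otherCells) :=
  isTriangulation_cells hGP hA isOriented_otherCells isFacet_boundaryRidges ridgesOk_otherCells
    (exists_isBoundary (by decide +kernel))

theorem HasCertSigns.not_preconnected (hA : HasCertSigns A) (hGP : InGeneralPosition A) :
    ¬ (flipGraph A).Preconnected :=
  (isLocked_of_check hA isLockedCheck_eq).not_preconnected hGP (by simp) (by norm_num)
    (isTriangulation_lockedCells hGP hA) (isTriangulation_otherCells hGP hA)
    cells_lockMasks_subset not_cells_lockMasks_subset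

end Main

end PointConfig

theorem mainTheorem3 :
    (∃ ε : ℝ, 0 < ε ∧ ∀ t : ℝ, 0 < t → t < ε →
      PointConfig.IsPerturbation (PointConfig.config17 0) (PointConfig.config17 t)) ∧
    ∀ t : ℝ, 0 < t →
      PointConfig.IsPerturbation (PointConfig.config17 0) (PointConfig.config17 t) →
      ∀ A' : Fin 17 → Fin 6 → ℝ,
        PointConfig.IsPerturbation (PointConfig.config17 t) A' →
        PointConfig.InGeneralPosition A' →
        ¬ (PointConfig.flipGraph A').Preconnected := by
  refine ⟨?_, fun t ht h A' hA' hGP => (h.hasCertSigns ht hA').not_preconnected hGP⟩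
  obtain ⟨ε, hε, h⟩ := Metric.eventually_nhds_iff.1 PointConfig.eventually_isPerturbation_config17
  refine ⟨ε, hε, fun t h0 ht => h ?_⟩
  rwa [Real.dist_eq, sub_zero, abs_of_pos h0]
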